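/- **Schwarz–Pick Lemma of the $n$-th derivative.** *Notation.* Let $\mathbb D=\{|z|<1\}$, let $\mathcal H$ be the set of analytic maps $\mathbb D\to\mathbb D$ and $\mathcal S$ the set of analytic maps $\mathbb D\to\overline{\mathbb D}$. Put $T_a(z)=\dfrac{z+a}{1+\bar a z}$ and $[z,w]=\dfrac{z-w}{1-\bar w z}$. For $z_0\in\mathbb D$ and $f\in\mathcal S$ let $\Delta_{z_0}f(z)=\dfrac{[f(z),f(z_0)]}{[z,z_0]}$ for $z\neq z_0$ and $\Delta_{z_0}f(z_0)=\dfrac{(1-|z_0|^2)f'(z_0)}{1-|f(z_0)|^2}$, with the convention $\Delta_{z_0}f\equiv 0$ if $f$ is a unimodular constant. For $k\ge 1$ the hyperbolic derivative of order $k$ is $H^kf(z_0)=(\Delta_{z_0}\circ\cdots\circ\Delta_{z_0}f)(z_0)$ ($k$ factors). A Blaschke product of degree $m$ is a function $e^{i\theta}\prod_{i=1}^m[z,a_i]$ with $\theta\in\mathbb R$ and $a_i\in\mathbb D$. Let $n\ge 1$, $z_0\in\mathbb D$ and $\gamma=(\gamma_0,\dots,\gamma_{n-1})\in\overline{\mathbb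 D}^{\,n}$, and let $\mathcal H(\gamma)$ be the set of all $f\in\mathcal H$ with $f(z_0)=\gamma_0$ and $H^kf(z_0)=\gamma_k$ for $1\le k\le n-1$. Define $F_1(x_1)=x_1$ and, for $m\ge 2$, $$F_m(x_1,\dots,x_m)=(1-|x_1|^2)F_{m-1}(x_2,\dots,x_m)-\bar x_1\sum_{k=2}^{m-1}F_{m-k}(x_2,\dots,x_{m-k+1})F_k(x_1,\dots,x_k).$$ The function $G_m(x_1,\dots,x_{m-1})=F_m(x_1,\dots,x_m)-(1-|x_1|^2)\cdots(1-|x_{m-1}|^2)x_m$ does not depend on $x_m$; in particular $G_1=0$. Let $\alpha_{m,k}=(-1)^{m-k}\dfrac{m!\,(m-1)!}{k!\,(k-1)!\,(m-k)!}$, and let $$A_{m,k}(x_1,\dots,x_{m-k+1})=m!\sum\prod_{i=1}^{m-k+1}\frac{x_i^{j_i}}{(i!)^{j_i}j_i!}$$ be the partial Bell polynomial, the sum running over all integers $j_1,\dots,j_{m-k+1}\ge 0$ with $\sum_i j_i=k$ and $\sum_i i\,j_i=m$. When $|\gamma_0|<1$, put for $m=1,\dots,n$, recursively, $$\rho_m=\frac{m!\prod_{k=0}^{m-1}(1-|\gamma_k|^2)}{(1-|z_0|^2)^m},\qquad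 c_m=\frac{1-|\gamma_0|^2}{(1-|z_0|^2)^m}\bigl[m!\,G_m(\gamma_1,\dots,\gamma_{m-1})-s_{m-1}\bigr],$$ $$s_{m-1}=\sum_{k=1}^{m-1}\alpha_{m,k}\frac{\bar z_0^{\,m-k}(1-|z_0|^2)^k(c_k+\rho_k\gamma_k)}{1-|\gamma_0|^2}-\sum_{k=2}^{m}k!\,(-\bar\gamma_0)^{k-1}A_{m,k}(D_1,\dots,D_{m-k+1}),$$ where $D_k=k!\,F_k(\gamma_1,\dots,\gamma_k)$. For $\varepsilon\in\overline{\mathbb D}$ let $$f_{\gamma,\varepsilon}(z)=T_{\gamma_0}(T_{-z_0}(z)\,T_{\gamma_1}(\cdots T_{-z_0}(z)\,T_{\gamma_{n-1}}(\varepsilon T_{-z_0}(z))\cdots)).$$ *Statement.* 1. Let $f\in\mathcal H(\gamma)$ and suppose that for some $1\le j\le n-1$ we have $|\gamma_k|<1$ for $1\le k<j$, $|\gamma_j|=1$ and $\gamma_{j+1}=\dots=\gamma_{n-1}=0$. Then $f^{(n)}(z_0)=c_n$ and, for all $z\in\mathbb D$, $$f(z)=T_{\gamma_0}(T_{-z_0}(z)\,T_{\gamma_1}(\cdots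 T_{-z_0}(z)\,T_{\gamma_{j-1}}(\gamma_jT_{-z_0}(z))\cdots)),$$ which is a Blaschke product of degree $j$. 2. Suppose that $|\gamma_k|<1$ for $0\le k\le n-1$. Then $$\{f^{(n)}(z_0):f\in\mathcal H(\gamma)\}=\overline{\mathbb D}(c_n,\rho_n)=\{f_{\gamma,\varepsilon}^{(n)}(z_0):\varepsilon\in\overline{\mathbb D}\}.$$ Every $f\in\mathcal H(\gamma)$ has on $\mathbb D$ the form $$f(z)=T_{\gamma_0}(T_{-z_0}(z)\,T_{\gamma_1}(\cdots T_{-z_0}(z)\,T_{\gamma_{n-1}}(T_{-z_0}(z)f^*(z))\cdots))$$ with some $f^*\in\mathcal S$. For $f\in\mathcal H(\gamma)$, we have $f^{(n)}(z_0)\in\partial\mathbb D(c_n,\rho_n)$ if and only if $f=f_{\gamma,\varepsilon}$ on $\mathbb D$ for some constant $\varepsilon$ with $|\varepsilon|=1$. For $|\varepsilon|=1$, $f_{\gamma,\varepsilon}$ is a Blaschke product of degree $n$. -/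

import Mathlib

open scoped ComplexConjugate

noncomputable section

namespace SchwarzPick

/-- The open unit disk `𝔻`. -/
def unitDisk : Set ℂ := Metric.ball 0 1

/-- `𝓗`: the analytic self-maps of the unit disk (only the values on the disk matter). -/
def IsSelfMap (f : ℂ → ℂ) : Prop :=
  DifferentiableOn ℂ f unitDisk ∧ Set.MapsTo f unitDisk unitDisk

/-- `𝓢`: the analytic maps from the unit disk to the closed unit disk. -/
def IsSchur (f : ℂ → ℂ) : Prop :=
  DifferentiableOn ℂ f unitDisk ∧ Set.MapsTo f unitDisk (Metric.closedBall 0 1)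

/-- The Möbius map `T_a(z) = (z + a) / (1 + \bar a z)`. -/
def mobius (a z : ℂ) : ℂ := (z + a) / (1 + conj a * z)

/-- `[z, w] = (z - w) / (1 - \bar w z)`. -/
def pdist (z w : ℂ) : ℂ := (z - w) / (1 - conj w * z)

/-- The hyperbolic difference quotient `Δ_{z₀} f`. If `f` is a constant of modulus one, then both
quotients have the form `0 / 0`, and `Δ_{z₀} f` is `0` on the disk, which is the usual convention
for the continuation of Schur's algorithm after it has terminated. -/
def hypDiff (z₀ : ℂ) (f : ℂ → ℂ) : ℂ → ℂ := fun z =>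
  open Classical in
  if z = z₀ then ((1 - ‖z₀‖ ^ 2 : ℝ) : ℂ) * deriv f z₀ / ((1 - ‖f z₀‖ ^ 2 : ℝ) : ℂ)
  else pdist (f z) (f z₀) / pdist z z₀

/-- The hyperbolic derivative of order `k`: `H^k f(z) = (Δ_z ∘ ⋯ ∘ Δ_z) f (z)`, with `k` factors. -/
def hypDeriv (k : ℕ) (f : ℂ → ℂ) (z : ℂ) : ℂ := (hypDiff z)^[k] f z

/-- The class `𝓗(γ)`: all `f ∈ 𝓗` with `f(z₀) = γ₀` and `H^k f(z₀) = γ_k` for `1 ≤ k ≤ n - 1`. -/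
def interpClass (n : ℕ) (z₀ : ℂ) (γ : ℕ → ℂ) : Set (ℂ → ℂ) :=
  {f | IsSelfMap f ∧ f z₀ = γ 0 ∧ ∀ k, 1 ≤ k → k < n → hypDeriv k f z₀ = γ k}

/-- `F_n(γ₁, …, γ_n)`: `F₁ = γ₁`, and for `n ≥ 2`
`F_n(γ₁, …, γ_n) = (1 - |γ₁|²) F_{n-1}(γ₂, …, γ_n)
  - \bar γ₁ ∑_{k=2}^{n-1} F_{n-k}(γ₂, …, γ_{n-k+1}) F_k(γ₁, …, γ_k)`
(below `k = i + 2`; the value for `n = 0` is not used). The sequence is indexed from `1`. -/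
def schurF : ℕ → (ℕ → ℂ) → ℂ
  | 0, _ => 0
  | 1, γ => γ 1
  | n + 2, γ =>
      ((1 - ‖γ 1‖ ^ 2 : ℝ) : ℂ) * schurF (n + 1) (fun i => γ (i + 1))
        - conj (γ 1) * ∑ i : Fin n,
            schurF (n - i.1) (fun m => γ (m + 1)) * schurF (i.1 + 2) γ
  termination_by n _ => n
  decreasing_by all_goals omega

/-- `G_n(γ₁, …, γ_{n-1}) = F_n(γ₁, …, γ_n) - (1 - |γ₁|²) ⋯ (1 - |γ_{n-1}|²) γ_n`, which does not
depend on `γ_n`, so that it may be evaluated at `γ_n = 0`. -/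
def schurG (n : ℕ) (γ : ℕ → ℂ) : ℂ := schurF n (Function.update γ n 0)

/-- The partial Bell polynomial `A_{n,k}(x₁, …, x_{n-k+1})`: the sum runs over all `j₁, …, j_{n-k+1}`
with `∑ j_i = k` and `∑ i j_i = n`. -/
def bellA (n k : ℕ) (x : ℕ → ℂ) : ℂ :=
  (n.factorial : ℂ) *
    ∑ j ∈ ((Finset.Icc 1 (n - k + 1)).piAntidiag k).filter
        (fun j => ∑ i ∈ Finset.Icc 1 (n - k + 1), i * j i = n),
      ∏ i ∈ Finset.Icc 1 (n - k + 1),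
        x i ^ j i / ((i.factorial : ℂ) ^ j i * ((j i).factorial : ℂ))

/-- `α_{n,k} = (-1)^{n-k} n! (n-1)! / (k! (k-1)! (n-k)!)` for `1 ≤ k ≤ n`. -/
def alphaCoeff (n k : ℕ) : ℂ :=
  (-1) ^ (n - k) * ((n.factorial : ℂ) * ((n - 1).factorial : ℂ)) /
    ((k.factorial : ℂ) * ((k - 1).factorial : ℂ) * ((n - k).factorial : ℂ))

/-- `ρ_n = n! ∏_{k=0}^{n-1} (1 - |γ_k|²) / (1 - |z₀|²)^n`. -/
def diskRadius (z₀ : ℂ) (γ : ℕ → ℂ) (n : ℕ) : ℝ :=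
  (n.factorial : ℝ) * (∏ k ∈ Finset.range n, (1 - ‖γ k‖ ^ 2)) / (1 - ‖z₀‖ ^ 2) ^ n

/-- `c_n = (1 - |γ₀|²) / (1 - |z₀|²)^n * (n! G_n(γ₁, …, γ_{n-1}) - s_{n-1})`, where
`s_{n-1} = ∑_{k=1}^{n-1} α_{n,k} \bar z₀^{n-k} (1 - |z₀|²)^k d_k / (1 - |γ₀|²)
  - ∑_{k=2}^n k! (-\bar γ₀)^{k-1} A_{n,k}(D₁, …, D_{n-k+1})`.
Here `d_k = c_k + ρ_k γ_k` is the value of `f^{(k)}(z₀)`, and `D_k = k! F_k(γ₁, …, γ_k)` that of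
Peschl's invariant derivative `D^k f(z₀)`, for `k < n`. In the first sum of the code, `k = i + 1`. -/
def diskCenter (z₀ : ℂ) (γ : ℕ → ℂ) (n : ℕ) : ℂ :=
  ((1 - ‖γ 0‖ ^ 2 : ℝ) : ℂ) / ((1 - ‖z₀‖ ^ 2 : ℝ) : ℂ) ^ n *
    ((n.factorial : ℂ) * schurG n γ -
      ((∑ i : Fin (n - 1),
          alphaCoeff n (i.1 + 1) * conj z₀ ^ (n - (i.1 + 1)) *
            ((1 - ‖z₀‖ ^ 2 : ℝ) : ℂ) ^ (i.1 + 1) *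
            (diskCenter z₀ γ (i.1 + 1) + (diskRadius z₀ γ (i.1 + 1) : ℂ) * γ (i.1 + 1)) /
              ((1 - ‖γ 0‖ ^ 2 : ℝ) : ℂ)) -
        ∑ k ∈ Finset.Icc 2 n,
          (k.factorial : ℂ) * (-conj (γ 0)) ^ (k - 1) *
            bellA n k (fun m => (m.factorial : ℂ) * schurF m γ)))
  termination_by n
  decreasing_by all_goals omega

/-- `T_{γ₀}(T_{-z₀}(z) T_{γ₁}(⋯ T_{-z₀}(z) T_{γ_{m-1}}(T_{-z₀}(z) h(z)) ⋯))`, with `m` nested maps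
`T_{γ₀}, …, T_{γ_{m-1}}`. -/
def nested (z₀ : ℂ) (γ : ℕ → ℂ) : ℕ → (ℂ → ℂ) → ℂ → ℂ
  | 0, h => h
  | m + 1, h => nested z₀ γ m (fun z => mobius (γ m) (mobius (-z₀) z * h z))

/-- `f_{γ,ε}(z) = T_{γ₀}(T_{-z₀}(z) T_{γ₁}(⋯ T_{-z₀}(z) T_{γ_{n-1}}(ε T_{-z₀}(z)) ⋯))`. -/
def extremal (n : ℕ) (z₀ : ℂ) (γ : ℕ → ℂ) (ε : ℂ) : ℂ → ℂ :=
  nested z₀ γ n (fun _ => ε)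

/-- On the unit disk, `f` is a Blaschke product of degree `n`. -/
def IsBlaschke (n : ℕ) (f : ℂ → ℂ) : Prop :=
  ∃ (θ : ℝ) (a : Fin n → ℂ), (∀ i, a i ∈ unitDisk) ∧
    ∀ z ∈ unitDisk, f z = Complex.exp (θ * Complex.I) * ∏ i, pdist z (a i)

end SchwarzPick

end

/-! ### Power series: the polynomials `schurF` and the partial Bell polynomials as coefficients -/

noncomputable section
namespace SchwarzPick
open PowerSeries

/-! Schur's algorithm at `z₀` reduces everything to one free parameter. While the hyperbolic
derivatives have modulus below one, `f` is recovered from its `n`-th iterated quotient `f*` by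
nesting Möbius maps, and every Schur function `f*` occurs (`eqOn_nested_iterate_hypDiff`,
`iterate_hypDiff_nested`, with `IsSchur.hypDiff` as the Schwarz–Pick input).

The core is the affine formula `f⁽ⁿ⁾(z₀) = c_n + ρ_n H^n f(z₀)` (`iteratedDeriv_eq_diskCenter_add`).
Let `φ_k` be the Taylor series at `0` of the `k`-th quotient composed with `T_{z₀}`. Each step of
the algorithm is a Möbius relation between `φ_k` and `X φ_{k+1}`, so the coefficients of `X φ_1` are
the `F_m`. Expanding `φ_0` in powers of `X φ_1` produces the Bell polynomials; computing its
coefficients by the chain rule for `f ∘ T_{z₀}` produces the `α_{m,k}`. Equating the two determines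
the top derivative.

The value `H^n f(z₀) = f*(z₀)` fills the closed unit disk, already for constant `f*`, and has
modulus one only if `f*` is constant, by the maximum principle. If some `|γ_j| = 1`, the algorithm
stops and `ρ_n = 0`. Multiplication by `T_{-z₀}` raises the degree of a Blaschke product by one, and
`T_a` preserves it (`IsBlaschke.mobius`). -/

theorem schurF_congr {n : ℕ} {γ δ : ℕ → ℂ} (h : ∀ i, 1 ≤ i → i ≤ n → γ i = δ i) :
    schurF n γ = schurF n δ := by
  induction n using Nat.strong_induction_on generalizing γ δ with
  | _ n ih =>
    match n with
    | 0 => simp [schurF]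
    | 1 => simpa [schurF] using h 1 le_rfl le_rfl
    | n + 2 =>
      rw [schurF, schurF, h 1 le_rfl (by omega),
        ih (n + 1) (by omega) (fun i h1 h2 => h (i + 1) (by omega) (by omega))]
      congr 2
      refine Finset.sum_congr rfl fun i _ => ?_
      have := i.2
      rw [ih (n - i.1) (by omega) (γ := fun m => γ (m + 1)) (δ := fun m => δ (m + 1))
          (fun j h1 h2 => h (j + 1) (by omega) (by omega)),
        ih (i.1 + 2) (by omega) (fun j h1 h2 => h j h1 (by omega))]

/-- In the recursion the convolution sum never reaches the last variable. It enters only through the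
first summand, which contributes one factor `1 - |γ_k|²` per level. -/
theorem schurF_eq_schurG_add {n : ℕ} (hn : 1 ≤ n) (γ : ℕ → ℂ) :
    schurF n γ = schurG n γ +
      (∏ k ∈ Finset.Ico 1 n, ((1 - ‖γ k‖ ^ 2 : ℝ) : ℂ)) * γ n := by
  induction n, hn using Nat.le_induction generalizing γ with
  | base => simp [schurG, schurF]
  | succ n hn ih =>
    obtain ⟨n, rfl⟩ := Nat.exists_eq_add_of_le' hn
    have hu : ∀ i, i ≠ n + 2 → Function.update γ (n + 2) 0 i = γ i := fun i hi =>
      Function.update_of_ne hi _ _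
    rw [schurG, schurF, schurF, hu 1 (by omega), ih,
      Finset.prod_eq_prod_Ico_succ_bot (by omega : 1 < n + 1 + 1), ← Finset.prod_Ico_add' _ 1 (n + 1) 1,
      schurG]
    have h1 : (fun i => Function.update γ (n + 2) 0 (i + 1)) =
        Function.update (fun i => γ (i + 1)) (n + 1) 0 := by
      funext i
      by_cases hi : i = n + 1
      · subst hi; simp
      · rw [hu _ (by omega), Function.update_of_ne hi]
    have h2 : ∑ i : Fin n, schurF (n - i.1) (fun m => Function.update γ (n + 2) 0 (m + 1)) *
          schurF (i.1 + 2) (Function.update γ (n + 2) 0) =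
        ∑ i : Fin n, schurF (n - i.1) (fun m => γ (m + 1)) * schurF (i.1 + 2) γ := by
      refine Finset.sum_congr rfl fun i _ => ?_
      have := i.2
      congr 1
      · exact schurF_congr fun j _ _ => hu _ (by omega)
      · exact schurF_congr fun j _ _ => hu _ (by omega)
    rw [h2, h1]
    ring

/-- Comparing coefficients in the Möbius relation reproduces the recursion of `schurF`: the
convolution term with the constant coefficient of `φ (k + 1)` supplies the factor `1 - |δ|²`, the
opposite end vanishes because of the factor `X`, and the rest is the quadratic sum. -/
theorem coeff_X_mul_eq_schurF {φ : ℕ → ℂ⟦X⟧} {δ : ℕ → ℂ}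
    (h : ∀ k, φ k * (1 + C (conj (δ k)) * (X * φ (k + 1))) = X * φ (k + 1) + C (δ k))
    (n k : ℕ) : coeff n (X * φ (k + 1)) = schurF n (fun i => δ (i + k)) := by
  have h0 : ∀ k, coeff 0 (φ k) = δ k := fun k => by
    simpa using congrArg (coeff 0) (h k)
  induction n using Nat.strong_induction_on generalizing k with
  | _ n ih =>
    match n with
    | 0 => simp [schurF]
    | 1 =>
      rw [show (1 : ℕ) = 0 + 1 from rfl, coeff_succ_X_mul, h0]
      simp [schurF, add_comm]
    | n + 2 =>
      have e := congrArg (coeff (n + 1)) (h (k + 1))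
      rw [mul_add, mul_one, map_add, map_add, coeff_C, if_neg (by omega), add_zero,
        mul_left_comm, coeff_C_mul, coeff_mul, Finset.Nat.sum_antidiagonal_eq_sum_range_succ_mk,
        Finset.sum_range_succ, Finset.sum_range_succ', h0] at e
      simp only [Nat.sub_self, coeff_zero_X_mul, mul_zero, add_zero, Nat.sub_zero] at e
      have hsh : (fun i => δ (i + (k + 1))) = fun i => δ (i + 1 + k) := by
        funext i; rw [add_assoc, add_comm k 1]
      have hs : ∑ i ∈ Finset.range n, coeff (i + 1) (φ (k + 1)) *
          coeff (n + 1 - (i + 1)) (X * φ (k + 1 + 1)) =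
          ∑ i : Fin n, schurF (n - i.1) (fun m => δ (m + 1 + k)) *
            schurF (i.1 + 2) (fun m => δ (m + k)) := by
        rw [Finset.sum_range]
        refine Finset.sum_congr rfl fun i _ => ?_
        have := i.2
        rw [show n + 1 - (i.1 + 1) = n - i.1 by omega, ih (n - i.1) (by omega),
          ← coeff_succ_X_mul, ih (i.1 + 1 + 1) (by omega), mul_comm]
        rw [hsh]
      rw [hs, ih (n + 1) (by omega), hsh, add_comm k 1] at e
      rw [schurF, coeff_succ_X_mul, add_comm k 1]
      have hn : ((1 - ‖δ (1 + k)‖ ^ 2 : ℝ) : ℂ) = 1 - conj (δ (1 + k)) * δ (1 + k) := by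
        rw [Complex.conj_mul']; push_cast; ring
      rw [hn]
      linear_combination e

/-- In `g^k - t^k = (∑ gⁱ t^{k-1-i}) (g - t)` the sum is divisible by `X^{k-1}`, so only
coefficients of index at most `m - k + 1` matter. -/
theorem coeff_pow_eq_coeff_trunc_pow {g t : ℂ⟦X⟧} {m k : ℕ} (hk : 1 ≤ k) (hkm : k ≤ m)
    (hg : X ∣ g) (ht : X ∣ t) (hgt : X ^ (m - k + 2) ∣ g - t) :
    coeff m (g ^ k) = coeff m (t ^ k) := by
  have : X ^ (m + 1) ∣ g ^ k - t ^ k := by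
    rw [← (Commute.all g t).geom_sum₂_mul]
    rw [show m + 1 = (k - 1) + (m - k + 2) by omega, pow_add]
    refine mul_dvd_mul (Finset.dvd_sum (s := Finset.range k) fun i hi => ?_) hgt
    rw [Finset.mem_range] at hi
    rw [show k - 1 = i + (k - 1 - i) by omega, pow_add]
    exact mul_dvd_mul (pow_dvd_pow_of_dvd hg _) (by
      rw [show i + (k - 1 - i) - i = k - 1 - i by omega]; exact pow_dvd_pow_of_dvd ht _)
  have := (X_pow_dvd_iff.1 this) m (by omega)
  rwa [map_sub, sub_eq_zero] at this

/-- After truncation this is the multinomial theorem for a finite sum of monomials. -/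
theorem coeff_pow_eq_bellA {g : ℂ⟦X⟧} {m k : ℕ} (hk : 1 ≤ k) (hkm : k ≤ m) (hg : X ∣ g) :
    (m.factorial : ℂ) * coeff m (g ^ k) =
      k.factorial * bellA m k (fun i => (i.factorial : ℂ) * coeff i g) := by
  set s := Finset.Icc 1 (m - k + 1)
  set t : ℂ⟦X⟧ := ∑ i ∈ s, PowerSeries.monomial (R := ℂ) i (coeff i g) with ht
  have hct : ∀ d, coeff d t = if d ∈ s then coeff d g else 0 := fun d => by
    simp [ht, coeff_monomial, Finset.sum_ite_eq]
  have hXt : X ∣ t := by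
    rw [X_dvd_iff, ← coeff_zero_eq_constantCoeff_apply, hct, if_neg (by simp [s])]
  rw [coeff_pow_eq_coeff_trunc_pow hk hkm hg hXt]
  · rw [ht, Finset.sum_pow_eq_sum_piAntidiag, map_sum, bellA, mul_left_comm, Finset.sum_filter]
    congr 1
    rw [Finset.mul_sum]
    refine Finset.sum_congr rfl fun j hj => ?_
    rw [Finset.mem_piAntidiag] at hj
    have hp : ∏ i ∈ s, (PowerSeries.monomial (R := ℂ) i (coeff i g)) ^ j i =
        PowerSeries.monomial (R := ℂ) (∑ i ∈ s, i * j i) (∏ i ∈ s, coeff i g ^ j i) := by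
      simp_rw [monomial_pow]
      induction s using Finset.induction_on with
      | empty => simp [monomial_zero_eq_C_apply]
      | insert a s ha ih =>
        rw [Finset.prod_insert ha, ih, monomial_mul_monomial, Finset.sum_insert ha,
          Finset.prod_insert ha, mul_comm (j a)]
    rw [hp, ← map_natCast (C (R := ℂ)), coeff_C_mul, coeff_monomial]
    by_cases h : m = ∑ i ∈ s, i * j i
    · rw [if_pos h, if_pos h.symm]
      have hm := Nat.multinomial_spec s j
      rw [hj.1] at hm
      have hm' : (∏ i ∈ s, ((j i).factorial : ℂ)) * (Nat.multinomial s j : ℂ) = k.factorial := by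
        exact_mod_cast hm
      rw [← hm', mul_right_comm, ← Finset.prod_mul_distrib, mul_comm]
      congr 1
      refine Finset.prod_congr rfl fun i _ => ?_
      have h1 : (i.factorial : ℂ) ≠ 0 := by exact_mod_cast i.factorial_ne_zero
      have h2 : ((j i).factorial : ℂ) ≠ 0 := by exact_mod_cast (j i).factorial_ne_zero
      rw [mul_pow]
      field_simp
    · rw [if_neg h, if_neg (Ne.symm h), mul_zero, mul_zero]
  · rw [X_pow_dvd_iff]
    intro d hd
    rw [map_sub, hct]
    split_ifs with h
    · exact sub_self _
    · have : d = 0 := by simp only [s, Finset.mem_Icc] at h; omega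
      rw [this, sub_zero, coeff_zero_eq_constantCoeff_apply]
      exact X_dvd_iff.1 hg

end SchwarzPick
end

/-! ### Möbius maps, Schur functions and Schur's algorithm -/

noncomputable section
namespace SchwarzPick

theorem mem_unitDisk {z : ℂ} : z ∈ unitDisk ↔ ‖z‖ < 1 := by simp [unitDisk]

theorem isOpen_unitDisk : IsOpen unitDisk := Metric.isOpen_ball

theorem unitDisk_mem_nhds {z : ℂ} (hz : z ∈ unitDisk) : unitDisk ∈ nhds z :=
  isOpen_unitDisk.mem_nhds hz

theorem zero_mem_unitDisk : (0 : ℂ) ∈ unitDisk := by simp [mem_unitDisk]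

theorem ofReal_one_sub_norm_sq (a : ℂ) : ((1 - ‖a‖ ^ 2 : ℝ) : ℂ) = 1 - conj a * a := by
  rw [Complex.conj_mul']; push_cast; ring

theorem one_sub_norm_sq_pos {a : ℂ} (ha : ‖a‖ < 1) : 0 < 1 - ‖a‖ ^ 2 := by
  nlinarith [norm_nonneg a]

theorem one_sub_conj_mul_self_ne_zero {a : ℂ} (ha : ‖a‖ < 1) : 1 - conj a * a ≠ 0 := by
  rw [← ofReal_one_sub_norm_sq]
  exact_mod_cast (one_sub_norm_sq_pos ha).ne'

theorem one_add_conj_mul_ne_zero {a z : ℂ} (ha : ‖a‖ < 1) (hz : ‖z‖ ≤ 1) :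
    1 + conj a * z ≠ 0 := by
  intro h
  have h1 : ‖conj a * z‖ = 1 := by
    rw [show conj a * z = -1 by linear_combination h]; simp
  rw [norm_mul, Complex.norm_conj] at h1
  nlinarith [norm_nonneg a, norm_nonneg z]

/-- The sign of the right side decides where `T_a` sends `z`; it serves inside the disk here and
outside it for the zeros of Blaschke products. -/
theorem normSq_sub_normSq_mobius (a z : ℂ) :
    ‖1 + conj a * z‖ ^ 2 - ‖z + a‖ ^ 2 = (1 - ‖a‖ ^ 2) * (1 - ‖z‖ ^ 2) := by
  simp only [← Complex.normSq_eq_norm_sq, Complex.normSq_apply]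
  simp
  ring

theorem norm_mobius_le {a z : ℂ} (ha : ‖a‖ < 1) (hz : ‖z‖ ≤ 1) : ‖mobius a z‖ ≤ 1 := by
  have h := normSq_sub_normSq_mobius a z
  rw [mobius, norm_div, div_le_one (norm_pos_iff.2 (one_add_conj_mul_ne_zero ha hz))]
  refine le_of_sq_le_sq ?_ (norm_nonneg _)
  nlinarith [mul_nonneg (one_sub_norm_sq_pos ha).le
    (by nlinarith [norm_nonneg z] : 0 ≤ 1 - ‖z‖ ^ 2)]

theorem norm_mobius_lt {a z : ℂ} (ha : ‖a‖ < 1) (hz : ‖z‖ < 1) : ‖mobius a z‖ < 1 := by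
  have h := normSq_sub_normSq_mobius a z
  rw [mobius, norm_div, div_lt_one (norm_pos_iff.2 (one_add_conj_mul_ne_zero ha hz.le))]
  refine lt_of_pow_lt_pow_left₀ 2 (norm_nonneg _) ?_
  nlinarith [mul_pos (one_sub_norm_sq_pos ha) (one_sub_norm_sq_pos hz)]

theorem pdist_eq_mobius (z w : ℂ) : pdist z w = mobius (-w) z := by
  simp [pdist, mobius, sub_eq_add_neg]

theorem mobius_mobius_neg {a z : ℂ} (ha : ‖a‖ < 1) (hz : ‖z‖ ≤ 1) :
    mobius a (mobius (-a) z) = z := by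
  have h1 := one_add_conj_mul_ne_zero (a := -a) (by simpa) hz
  have h3 := one_add_conj_mul_ne_zero ha (norm_mobius_le (a := -a) (by simpa) hz)
  rw [mobius, div_eq_iff h3]
  have h4 : mobius (-a) z * (1 + conj (-a) * z) = z + -a := div_mul_cancel₀ _ h1
  refine mul_right_cancel₀ h1 ?_
  rw [map_neg] at h4 ⊢
  linear_combination (1 - z * conj a) * h4

theorem mobius_neg_mobius {a z : ℂ} (ha : ‖a‖ < 1) (hz : ‖z‖ ≤ 1) :
    mobius (-a) (mobius a z) = z := by
  simpa using mobius_mobius_neg (a := -a) (by simpa) hz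

theorem mobius_zero_right (a : ℂ) : mobius a 0 = a := by simp [mobius]

theorem mobius_neg_self (a : ℂ) : mobius (-a) a = 0 := by simp [mobius]

theorem mobius_neg_eq_zero {a z : ℂ} (ha : ‖a‖ < 1) (hz : ‖z‖ ≤ 1) :
    mobius (-a) z = 0 ↔ z = a := by
  rw [mobius, div_eq_zero_iff, or_iff_left (one_add_conj_mul_ne_zero (by simpa) hz)]
  exact ⟨fun h => by linear_combination h, fun h => by rw [h]; ring⟩

theorem IsSchur.norm_le {f : ℂ → ℂ} (hf : IsSchur f) {z : ℂ} (hz : z ∈ unitDisk) : ‖f z‖ ≤ 1 := by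
  simpa using hf.2 hz

theorem IsSelfMap.isSchur {f : ℂ → ℂ} (hf : IsSelfMap f) : IsSchur f :=
  ⟨hf.1, fun _ hz => Metric.ball_subset_closedBall (hf.2 hz)⟩

theorem IsSchur.analyticAt {f : ℂ → ℂ} (hf : IsSchur f) {z : ℂ} (hz : z ∈ unitDisk) :
    AnalyticAt ℂ f z := hf.1.analyticAt (unitDisk_mem_nhds hz)

theorem isSchur_const {c : ℂ} (hc : ‖c‖ ≤ 1) : IsSchur fun _ => c :=
  ⟨differentiableOn_const c, fun _ _ => by simpa using hc⟩

theorem IsSchur.mobius {f : ℂ → ℂ} (hf : IsSchur f) {a : ℂ} (ha : ‖a‖ < 1) :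
    IsSchur fun z => mobius a (f z) :=
  ⟨(hf.1.add_const a).div ((hf.1.const_mul _).const_add 1)
      fun z hz => one_add_conj_mul_ne_zero ha (hf.norm_le hz),
    fun z hz => by simpa using norm_mobius_le ha (hf.norm_le hz)⟩

theorem isSelfMap_mobius {a : ℂ} (ha : ‖a‖ < 1) : IsSelfMap (mobius a) := by
  have hid : IsSchur (fun z => z) := ⟨differentiableOn_id, Metric.ball_subset_closedBall⟩
  exact ⟨(hid.mobius ha).1, fun z hz => mem_unitDisk.2 (norm_mobius_lt ha (mem_unitDisk.1 hz))⟩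

theorem IsSchur.comp {f g : ℂ → ℂ} (hf : IsSchur f) (hg : IsSelfMap g) :
    IsSchur fun z => f (g z) :=
  ⟨hf.1.comp hg.1 hg.2, fun _ hz => hf.2 (hg.2 hz)⟩

/-- A single backward step of Schur's algorithm yields an analytic self-map of the disk. -/
theorem IsSchur.isSelfMap_step {h : ℂ → ℂ} (hh : IsSchur h) {a z₀ : ℂ} (ha : ‖a‖ < 1)
    (hz₀ : z₀ ∈ unitDisk) :
    IsSelfMap fun z => SchwarzPick.mobius a (SchwarzPick.mobius (-z₀) z * h z) := by
  have h0 : ‖-z₀‖ < 1 := by simpa using mem_unitDisk.1 hz₀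
  have hm : IsSchur fun z => SchwarzPick.mobius (-z₀) z * h z :=
    ⟨(isSelfMap_mobius h0).1.mul hh.1, fun z hz => by
      rw [mem_closedBall_zero_iff, norm_mul]
      exact mul_le_one₀ (norm_mobius_le h0 (mem_unitDisk.1 hz).le) (norm_nonneg _) (hh.norm_le hz)⟩
  refine ⟨(hm.mobius ha).1, fun z hz => mem_unitDisk.2 (norm_mobius_lt ha ?_)⟩
  rw [norm_mul]
  exact mul_lt_one_of_nonneg_of_lt_one_left (norm_nonneg _)
    (norm_mobius_lt h0 (mem_unitDisk.1 hz)) (hh.norm_le hz)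

theorem IsSchur.eqOn_const {f : ℂ → ℂ} (hf : IsSchur f) {z₀ : ℂ} (hz₀ : z₀ ∈ unitDisk)
    (h : ‖f z₀‖ = 1) : Set.EqOn f (fun _ => f z₀) unitDisk :=
  Complex.eqOn_of_isPreconnected_of_isMaxOn_norm (convex_ball (0 : ℂ) 1).isPreconnected
    isOpen_unitDisk hf.1 hz₀ fun _ hz => by simpa [h] using hf.norm_le hz

theorem hypDiff_congr {f g : ℂ → ℂ} {z₀ : ℂ} (hz₀ : z₀ ∈ unitDisk) (h : Set.EqOn f g unitDisk) :
    Set.EqOn (hypDiff z₀ f) (hypDiff z₀ g) unitDisk := fun z hz => by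
  have hd : deriv f z₀ = deriv g z₀ :=
    Filter.EventuallyEq.deriv_eq (h.eventuallyEq_of_mem (unitDisk_mem_nhds hz₀))
  simp only [hypDiff, h hz, h hz₀, hd]

theorem hypDiff_const (z₀ c z : ℂ) : hypDiff z₀ (fun _ => c) z = 0 := by
  simp [hypDiff, pdist]

theorem hypDiff_eqOn_zero {f : ℂ → ℂ} (hf : IsSchur f) {z₀ : ℂ} (hz₀ : z₀ ∈ unitDisk)
    (h : ‖f z₀‖ = 1) : Set.EqOn (hypDiff z₀ f) (fun _ => 0) unitDisk := fun _ hz =>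
  (hypDiff_congr hz₀ (hf.eqOn_const hz₀ h) hz).trans (hypDiff_const _ _ _)

theorem hasDerivAt_mobius_neg_self {a : ℂ} (ha : ‖a‖ < 1) :
    HasDerivAt (mobius (-a)) (1 / (1 - conj a * a)) a := by
  have h1 : HasDerivAt (fun z : ℂ => z + -a) 1 a := (hasDerivAt_id a).add_const _
  have h2 : HasDerivAt (fun z : ℂ => 1 + conj (-a) * z) (conj (-a) * 1) a :=
    ((hasDerivAt_id a).const_mul _).const_add 1
  have h3 := one_sub_conj_mul_self_ne_zero ha
  have h4 : 1 + conj (-a) * a = 1 - conj a * a := by simp; ring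
  have := h1.div h2 (by rwa [h4])
  convert! this using 1
  rw [h4]
  field_simp
  ring

/-- Exhibits the singularity at `z₀` as removable, since `dslope` of an analytic function is
analytic. -/
theorem hypDiff_eq_dslope {f : ℂ → ℂ} (hf : IsSchur f) {z₀ : ℂ} (hz₀ : z₀ ∈ unitDisk)
    (h : ‖f z₀‖ < 1) : Set.EqOn (hypDiff z₀ f)
      (fun z => dslope (fun w => mobius (-f z₀) (f w)) z₀ z * (1 - conj z₀ * z)) unitDisk := by
  intro z hz
  have hz1 := one_add_conj_mul_ne_zero (a := -z₀) (by simpa using mem_unitDisk.1 hz₀)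
    (mem_unitDisk.1 hz).le
  by_cases hzz : z = z₀
  · subst hzz
    have hd := (hf.analyticAt hz).differentiableAt.hasDerivAt
    have := (hasDerivAt_mobius_neg_self h).comp z hd
    have h2 : deriv (fun w => mobius (-f z) (f w)) z = 1 / (1 - conj (f z) * f z) * deriv f z :=
      this.deriv
    simp only [hypDiff, dslope_same, h2, if_true, ofReal_one_sub_norm_sq]
    ring
  · have hne := sub_ne_zero.2 hzz
    simp only [hypDiff, if_neg hzz, dslope_of_ne _ hzz, slope_def_field, mobius_neg_self,
      pdist_eq_mobius _ (f z₀), sub_zero]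
    simp only [map_neg] at hz1
    rw [pdist]
    have hz2 : 1 - conj z₀ * z ≠ 0 := by convert hz1 using 1; ring
    field_simp

theorem IsSchur.continuousOn {f : ℂ → ℂ} (hf : IsSchur f) : ContinuousOn f unitDisk :=
  hf.1.continuousOn

theorem differentiableOn_hypDiff {f : ℂ → ℂ} (hf : IsSchur f) {z₀ : ℂ} (hz₀ : z₀ ∈ unitDisk) :
    DifferentiableOn ℂ (hypDiff z₀ f) unitDisk := by
  rcases (hf.norm_le hz₀).eq_or_lt with h | h
  · exact (differentiableOn_const 0).congr (hypDiff_eqOn_zero hf hz₀ h)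
  · refine DifferentiableOn.congr (DifferentiableOn.mul ?_ ?_) (hypDiff_eq_dslope hf hz₀ h)
    · exact (Complex.differentiableOn_dslope (unitDisk_mem_nhds hz₀)).2 (hf.mobius (by simpa)).1
    · fun_prop

theorem unitDisk_subset_closure_diff (z₀ : ℂ) :
    unitDisk ⊆ closure (unitDisk \ {z₀}) := by
  have h : closure ({z₀}ᶜ : Set ℂ) = Set.univ := (dense_compl_singleton z₀).closure_eq
  intro z hz
  have := isOpen_unitDisk.inter_closure (t := ({z₀}ᶜ : Set ℂ))
  exact this ⟨hz, by rw [h]; trivial⟩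

/-- The division-free form of the quotient; at `z₀` both sides vanish. -/
theorem mobius_neg_mul_hypDiff (f : ℂ → ℂ) {z₀ : ℂ} (hz₀ : z₀ ∈ unitDisk) {z : ℂ}
    (hz : z ∈ unitDisk) : mobius (-z₀) z * hypDiff z₀ f z = mobius (-f z₀) (f z) := by
  by_cases h : z = z₀
  · subst h; simp [mobius_neg_self]
  · have := (mobius_neg_eq_zero (mem_unitDisk.1 hz₀) (mem_unitDisk.1 hz).le).not.2 h
    simp only [hypDiff, if_neg h, pdist_eq_mobius]
    field_simp

theorem IsSchur.hypDiff {f : ℂ → ℂ} (hf : IsSchur f) {z₀ : ℂ} (hz₀ : z₀ ∈ unitDisk) :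
    IsSchur (hypDiff z₀ f) := by
  refine ⟨differentiableOn_hypDiff hf hz₀, fun z hz => ?_⟩
  rcases (hf.norm_le hz₀).eq_or_lt with h | h
  · rw [hypDiff_eqOn_zero hf hz₀ h hz]; simp
  · have h0 := mem_unitDisk.1 hz₀
    -- Moving `z₀` and `f z₀` to the origin makes the Schwarz lemma applicable. It gives the bound
    -- off `z₀`, and continuity carries it to `z₀`.
    have hu : IsSchur fun w => SchwarzPick.mobius (-f z₀) (f (SchwarzPick.mobius z₀ w)) :=
      (hf.comp (isSelfMap_mobius h0)).mobius (by simpa)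
    have hpt : ∀ w ∈ unitDisk \ {z₀}, SchwarzPick.hypDiff z₀ f w ∈ Metric.closedBall (0 : ℂ) 1 := by
      rintro w ⟨hw, hwz⟩
      have hw1 := mem_unitDisk.1 hw
      have hv : ‖SchwarzPick.mobius (-z₀) w‖ < 1 := norm_mobius_lt (by simpa) hw1
      have := Complex.norm_le_norm_of_mapsTo_ball hu.1 hu.2
        (by rw [mobius_zero_right, mobius_neg_self]) hv
      rw [mobius_mobius_neg h0 hw1.le, ← mobius_neg_mul_hypDiff f hz₀ hw, norm_mul] at this
      rw [mem_closedBall_zero_iff]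
      exact le_of_mul_le_mul_left (this.trans_eq (mul_one _).symm)
        (norm_pos_iff.2 ((mobius_neg_eq_zero h0 hw1.le).not.2 hwz))
    exact Metric.isClosed_closedBall.closure_subset_iff.2 (Set.mapsTo_iff_image_subset.1 hpt)
      (((differentiableOn_hypDiff hf hz₀).continuousOn.continuousWithinAt hz).mono
        Set.sdiff_subset |>.mem_closure_image (unitDisk_subset_closure_diff z₀ hz))

theorem eq_mobius_hypDiff {f : ℂ → ℂ} (hf : IsSchur f) {z₀ : ℂ} (hz₀ : z₀ ∈ unitDisk)
    (h : ‖f z₀‖ < 1) {z : ℂ} (hz : z ∈ unitDisk) :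
    f z = mobius (f z₀) (mobius (-z₀) z * hypDiff z₀ f z) := by
  rw [mobius_neg_mul_hypDiff f hz₀ hz, mobius_mobius_neg h (hf.norm_le hz)]

/-- Off `z₀` the factor `T_{-z₀}` cancels; density of the punctured disk gives the value at `z₀`. -/
theorem hypDiff_step {h : ℂ → ℂ} (hh : IsSchur h) {a z₀ : ℂ} (ha : ‖a‖ < 1)
    (hz₀ : z₀ ∈ unitDisk) :
    Set.EqOn (hypDiff z₀ fun z => mobius a (mobius (-z₀) z * h z)) h unitDisk := by
  have hs := (hh.isSelfMap_step ha hz₀).isSchur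
  refine Set.EqOn.of_subset_closure (s := unitDisk \ {z₀}) ?_ (hs.hypDiff hz₀).continuousOn
    hh.continuousOn Set.sdiff_subset (unitDisk_subset_closure_diff z₀)
  rintro z ⟨hz, hzz⟩
  have h0 := mem_unitDisk.1 hz₀
  have h1 := mobius_neg_mul_hypDiff (fun z => mobius a (mobius (-z₀) z * h z)) hz₀ hz
  rw [mobius_neg_self, zero_mul, mobius_zero_right, mobius_neg_mobius ha] at h1
  · exact mul_left_cancel₀ ((mobius_neg_eq_zero h0 (mem_unitDisk.1 hz).le).not.2 hzz) h1
  · rw [norm_mul]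
    exact mul_le_one₀ (norm_mobius_le (by simpa) (mem_unitDisk.1 hz).le) (norm_nonneg _)
      (hh.norm_le hz)

theorem IsSchur.iterate_hypDiff {f : ℂ → ℂ} (hf : IsSchur f) {z₀ : ℂ} (hz₀ : z₀ ∈ unitDisk)
    (k : ℕ) : IsSchur ((SchwarzPick.hypDiff z₀)^[k] f) := by
  induction k with
  | zero => exact hf
  | succ k ih => rw [Function.iterate_succ_apply']; exact ih.hypDiff hz₀

theorem iterate_hypDiff_congr {f g : ℂ → ℂ} {z₀ : ℂ} (hz₀ : z₀ ∈ unitDisk)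
    (h : Set.EqOn f g unitDisk) (k : ℕ) :
    Set.EqOn ((hypDiff z₀)^[k] f) ((hypDiff z₀)^[k] g) unitDisk := by
  induction k with
  | zero => exact h
  | succ k ih =>
    rw [Function.iterate_succ_apply', Function.iterate_succ_apply']; exact hypDiff_congr hz₀ ih

theorem nested_congr (z₀ : ℂ) (γ : ℕ → ℂ) (m : ℕ) {g h : ℂ → ℂ} (e : Set.EqOn g h unitDisk) :
    Set.EqOn (nested z₀ γ m g) (nested z₀ γ m h) unitDisk := by
  induction m generalizing g h with
  | zero => exact e
  | succ m ih => exact ih fun z hz => by simp only [e hz]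

theorem IsSchur.nested {h : ℂ → ℂ} (hh : IsSchur h) {z₀ : ℂ} (hz₀ : z₀ ∈ unitDisk) {γ : ℕ → ℂ}
    {m : ℕ} (hγ : ∀ k < m, ‖γ k‖ < 1) : IsSchur (nested z₀ γ m h) := by
  induction m generalizing h with
  | zero => exact hh
  | succ m ih =>
    exact ih (hh.isSelfMap_step (hγ m (by omega)) hz₀).isSchur fun k hk => hγ k (by omega)

theorem IsSelfMap.nested {h : ℂ → ℂ} (hh : IsSelfMap h) {z₀ : ℂ} (hz₀ : z₀ ∈ unitDisk) {γ : ℕ → ℂ}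
    {m : ℕ} (hγ : ∀ k < m, ‖γ k‖ < 1) : IsSelfMap (nested z₀ γ m h) := by
  induction m generalizing h with
  | zero => exact hh
  | succ m ih =>
    exact ih (hh.isSchur.isSelfMap_step (hγ m (by omega)) hz₀) fun k hk => hγ k (by omega)

theorem iterate_hypDiff_nested {h : ℂ → ℂ} (hh : IsSchur h) {z₀ : ℂ} (hz₀ : z₀ ∈ unitDisk)
    {γ : ℕ → ℂ} {m : ℕ} (hγ : ∀ k < m, ‖γ k‖ < 1) :
    Set.EqOn ((hypDiff z₀)^[m] (nested z₀ γ m h)) h unitDisk := by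
  induction m generalizing h with
  | zero => exact fun z _ => rfl
  | succ m ih =>
    have hm := hγ m (by omega)
    rw [Function.iterate_succ_apply']
    exact (hypDiff_congr hz₀ (ih (hh.isSelfMap_step hm hz₀).isSchur
      fun k hk => hγ k (by omega))).trans (hypDiff_step hh hm hz₀)

theorem iterate_hypDiff_nested_apply {h : ℂ → ℂ} (hh : IsSchur h) {z₀ : ℂ} (hz₀ : z₀ ∈ unitDisk)
    {γ : ℕ → ℂ} {m : ℕ} (hγ : ∀ k < m, ‖γ k‖ < 1) {k : ℕ} (hk : k < m) :
    (hypDiff z₀)^[k] (nested z₀ γ m h) z₀ = γ k := by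
  induction m generalizing h with
  | zero => omega
  | succ m ih =>
    have hs := (hh.isSelfMap_step (hγ m (by omega)) hz₀).isSchur
    have hγ' : ∀ k < m, ‖γ k‖ < 1 := fun k hk => hγ k (by omega)
    rcases (Nat.lt_succ_iff.1 hk).eq_or_lt with rfl | hk
    · rw [nested, iterate_hypDiff_nested hs hz₀ hγ' hz₀]
      simp only [mobius_neg_self, zero_mul, mobius_zero_right]
    · exact ih hs hγ' hk

theorem eqOn_nested_iterate_hypDiff {f : ℂ → ℂ} (hf : IsSchur f) {z₀ : ℂ} (hz₀ : z₀ ∈ unitDisk)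
    {γ : ℕ → ℂ} {m : ℕ} (hγ : ∀ k < m, ‖γ k‖ < 1)
    (h : ∀ k < m, (hypDiff z₀)^[k] f z₀ = γ k) :
    Set.EqOn f (nested z₀ γ m ((hypDiff z₀)^[m] f)) unitDisk := by
  induction m with
  | zero => exact fun z _ => rfl
  | succ m ih =>
    refine (ih (fun k hk => hγ k (by omega)) fun k hk => h k (by omega)).trans
      (nested_congr z₀ γ m fun z hz => ?_)
    have hm := h m (by omega)
    rw [Function.iterate_succ_apply', ← hm]
    exact eq_mobius_hypDiff (hf.iterate_hypDiff hz₀ m) hz₀ (by rw [hm]; exact hγ m (by omega)) hz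

end SchwarzPick
end

/-! ### Taylor series and composition with Möbius maps -/

noncomputable section
namespace SchwarzPick
open PowerSeries

/-- The Taylor series of `f` at `z`. -/
def taylorPS (f : ℂ → ℂ) (z : ℂ) : ℂ⟦X⟧ := PowerSeries.mk fun k => iteratedDeriv k f z / k.factorial

theorem coeff_taylorPS (f : ℂ → ℂ) (z : ℂ) (k : ℕ) :
    coeff k (taylorPS f z) = iteratedDeriv k f z / k.factorial := coeff_mk _ _

theorem taylorPS_congr {f g : ℂ → ℂ} {z : ℂ} (h : f =ᶠ[nhds z] g) : taylorPS f z = taylorPS g z := by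
  ext k
  rw [coeff_taylorPS, coeff_taylorPS, h.iteratedDeriv_eq]

theorem taylorPS_const (c z : ℂ) : taylorPS (fun _ => c) z = C c := by
  ext k
  rw [coeff_taylorPS, iteratedDeriv_const, coeff_C]
  split_ifs with h <;> simp [h]

theorem taylorPS_sub_const (z : ℂ) : taylorPS (fun w => w - z) z = X := by
  ext k
  rw [coeff_taylorPS, coeff_X, iteratedDeriv_comp_sub_const (f := fun w => w)]
  simp only [sub_self, iteratedDeriv_fun_id_zero]
  split_ifs with h <;> simp [h]

theorem taylorPS_add {f g : ℂ → ℂ} {z : ℂ} (hf : AnalyticAt ℂ f z) (hg : AnalyticAt ℂ g z) :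
    taylorPS (fun w => f w + g w) z = taylorPS f z + taylorPS g z := by
  ext k
  rw [map_add, coeff_taylorPS, coeff_taylorPS, coeff_taylorPS, ← add_div]
  congr 1
  exact iteratedDeriv_add hf.contDiffAt hg.contDiffAt

theorem taylorPS_mul {f g : ℂ → ℂ} {z : ℂ} (hf : AnalyticAt ℂ f z) (hg : AnalyticAt ℂ g z) :
    taylorPS (fun w => f w * g w) z = taylorPS f z * taylorPS g z := by
  ext k
  rw [coeff_mul, Finset.Nat.sum_antidiagonal_eq_sum_range_succ_mk, coeff_taylorPS,
    iteratedDeriv_fun_mul hf.contDiffAt hg.contDiffAt, Finset.sum_div]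
  refine Finset.sum_congr rfl fun i hi => ?_
  have hik : i ≤ k := by simpa [Nat.lt_succ_iff] using hi
  rw [coeff_taylorPS, coeff_taylorPS, Nat.cast_choose ℂ hik]
  have h1 : (i.factorial : ℂ) ≠ 0 := by exact_mod_cast i.factorial_ne_zero
  have h2 : ((k - i).factorial : ℂ) ≠ 0 := by exact_mod_cast (k - i).factorial_ne_zero
  have h3 : (k.factorial : ℂ) ≠ 0 := by exact_mod_cast k.factorial_ne_zero
  field_simp

theorem coeff_zero_taylorPS (f : ℂ → ℂ) (z : ℂ) : coeff 0 (taylorPS f z) = f z := by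
  simp [coeff_taylorPS]

/-- Iterating `f(z) = f(z₀) + (z - z₀) dslope f z₀ z` and composing with `T` gives a chain rule of
all orders with a remainder divisible by `(T - z₀)^N`. -/
theorem exists_taylorPS_comp_eq {z₀ : ℂ} {T : ℂ → ℂ} (hT : AnalyticAt ℂ T 0)
    (hT0 : T 0 = z₀) (N : ℕ) {f : ℂ → ℂ} (hf : AnalyticAt ℂ f z₀) :
    ∃ r : ℂ⟦X⟧, taylorPS (fun w => f (T w)) 0 =
      ∑ k ∈ Finset.range N, C (coeff k (taylorPS f z₀)) * taylorPS (fun w => T w - z₀) 0 ^ k +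
        taylorPS (fun w => T w - z₀) 0 ^ N * r := by
  induction N generalizing f with
  | zero => exact ⟨taylorPS (fun w => f (T w)) 0, by simp⟩
  | succ N ih =>
    have hg : AnalyticAt ℂ (dslope f z₀) z₀ := by
      obtain ⟨p, hp⟩ := hf
      exact ⟨_, hp.has_fpower_series_dslope_fslope⟩
    have hfg : ∀ z, f z = f z₀ + (z - z₀) * dslope f z₀ z := fun z => by
      have := sub_smul_dslope f z₀ z
      rw [smul_eq_mul] at this
      rw [this]; ring
    obtain ⟨r, hr⟩ := ih hg
    refine ⟨r, ?_⟩
    have e1 : taylorPS f z₀ = C (f z₀) + X * taylorPS (dslope f z₀) z₀ := by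
      rw [← taylorPS_const (f z₀) z₀, ← taylorPS_sub_const, ← taylorPS_mul (by fun_prop) hg,
        ← taylorPS_add (by fun_prop) (by fun_prop)]
      exact congrArg (taylorPS · z₀) (funext hfg)
    have hgT : AnalyticAt ℂ (fun w => dslope f z₀ (T w)) 0 :=
      AnalyticAt.fun_comp (by rwa [hT0]) hT
    have e2 : taylorPS (fun w => f (T w)) 0 = C (f z₀) + taylorPS (fun w => T w - z₀) 0 *
        taylorPS (fun w => dslope f z₀ (T w)) 0 := by
      rw [← taylorPS_const (f z₀) 0, ← taylorPS_mul (by fun_prop) hgT,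
        ← taylorPS_add (by fun_prop) (by fun_prop)]
      exact congrArg (taylorPS · 0) (funext fun w => hfg (T w))
    rw [e2, hr, Finset.sum_range_succ', coeff_zero_taylorPS, mul_add, Finset.mul_sum]
    have e3 : ∀ k, coeff (k + 1) (taylorPS f z₀) = coeff k (taylorPS (dslope f z₀) z₀) := fun k => by
      rw [e1, map_add, coeff_succ_X_mul, coeff_C, if_neg (by omega), zero_add]
    simp only [e3, pow_succ', pow_zero, mul_one]
    rw [← add_assoc, add_comm (C (f z₀))]
    congr 1
    · congr 1
      exact Finset.sum_congr rfl fun k _ => by ring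
    · ring

theorem one_add_C_mul_X_mul_rescale (b : ℂ) :
    (1 + C b * X) * rescale (-b) (PowerSeries.mk 1) = 1 := by
  have := congrArg (rescale (-b)) (mk_one_mul_one_sub_eq_one ℂ)
  rw [map_mul, map_sub, map_one, rescale_X] at this
  rwa [map_neg, neg_mul, sub_neg_eq_add, mul_comm] at this

theorem taylorPS_mobius_sub {z₀ : ℂ} (hz₀ : ‖z₀‖ < 1) :
    taylorPS (fun w => mobius z₀ w - z₀) 0 =
      C ((1 - ‖z₀‖ ^ 2 : ℝ) : ℂ) * X * rescale (-conj z₀) (PowerSeries.mk 1) := by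
  have hm : AnalyticAt ℂ (mobius z₀) 0 :=
    (isSelfMap_mobius hz₀).isSchur.analyticAt zero_mem_unitDisk
  have h : taylorPS (fun w => mobius z₀ w - z₀) 0 * (1 + C (conj z₀) * X) =
      C ((1 - ‖z₀‖ ^ 2 : ℝ) : ℂ) * X := by
    rw [← taylorPS_sub_const 0, ← taylorPS_const _ 0, ← taylorPS_const _ 0,
      ← map_one (C (R := ℂ)), ← taylorPS_const _ 0, ← taylorPS_mul (by fun_prop) (by fun_prop),
      ← taylorPS_mul (by fun_prop) (by fun_prop), ← taylorPS_add (by fun_prop) (by fun_prop),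
      ← taylorPS_mul (by fun_prop) (by fun_prop)]
    refine taylorPS_congr ?_
    filter_upwards [unitDisk_mem_nhds zero_mem_unitDisk] with w hw
    have := one_add_conj_mul_ne_zero hz₀ (mem_unitDisk.1 hw).le
    have hw' : mobius z₀ w * (1 + conj z₀ * w) = w + z₀ := div_mul_cancel₀ _ this
    rw [ofReal_one_sub_norm_sq, sub_zero]
    linear_combination hw'
  rw [← h, mul_assoc, one_add_C_mul_X_mul_rescale, mul_one]

/-- The negative binomial series for `(1 + conj z₀ w)^{-k}`, shifted by `w^k`. -/
theorem coeff_taylorPS_mobius_sub_pow {z₀ : ℂ} (hz₀ : ‖z₀‖ < 1) {m k : ℕ} (hk : 1 ≤ k)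
    (hkm : k ≤ m) : coeff m (taylorPS (fun w => mobius z₀ w - z₀) 0 ^ k) =
      ((1 - ‖z₀‖ ^ 2 : ℝ) : ℂ) ^ k * ((-conj z₀) ^ (m - k) * (m - 1).choose (k - 1)) := by
  obtain ⟨k, rfl⟩ := Nat.exists_eq_add_of_le' hk
  obtain ⟨d, rfl⟩ := Nat.exists_eq_add_of_le' hkm
  rw [taylorPS_mobius_sub hz₀, mul_pow, mul_pow, ← map_pow, ← map_pow, mul_assoc, coeff_C_mul,
    coeff_X_pow_mul, coeff_rescale, mk_one_pow_eq_mk_choose_add, coeff_mk]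
  congr 4 <;> omega

theorem factorial_mul_coeff_taylorPS_comp_mobius {f : ℂ → ℂ} {z₀ : ℂ} (hz₀ : ‖z₀‖ < 1)
    (hf : AnalyticAt ℂ f z₀) {m : ℕ} (hm : 1 ≤ m) :
    (m.factorial : ℂ) * coeff m (taylorPS (fun w => f (mobius z₀ w)) 0) =
      ∑ k ∈ Finset.Icc 1 m, alphaCoeff m k * conj z₀ ^ (m - k) *
        ((1 - ‖z₀‖ ^ 2 : ℝ) : ℂ) ^ k * iteratedDeriv k f z₀ := by
  have hT : AnalyticAt ℂ (mobius z₀) 0 :=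
    (isSelfMap_mobius hz₀).isSchur.analyticAt zero_mem_unitDisk
  obtain ⟨r, hr⟩ := exists_taylorPS_comp_eq hT (mobius_zero_right z₀) (m + 1) hf
  -- With `m + 1` terms the remainder is divisible by `X^{m+1}`.
  have h1 : coeff m (taylorPS (fun w => mobius z₀ w - z₀) 0 ^ (m + 1) * r) = 0 := by
    rw [taylorPS_mobius_sub hz₀, mul_comm (C _), mul_assoc, mul_pow, mul_assoc]
    exact X_pow_dvd_iff.1 (dvd_mul_right _ _) m (by omega)
  rw [hr, map_add, h1, add_zero, map_sum, Finset.mul_sum, Finset.range_eq_Ico,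
    Finset.sum_eq_sum_Ico_succ_bot (by omega), coeff_C_mul, pow_zero, coeff_one,
    if_neg (by omega), mul_zero, mul_zero, zero_add]
  refine Finset.sum_congr (by ext; simp) fun k hk => ?_
  obtain ⟨hk1, hkm⟩ := Finset.mem_Icc.1 hk
  rw [coeff_C_mul, coeff_taylorPS_mobius_sub_pow hz₀ hk1 hkm, coeff_taylorPS, alphaCoeff,
    Nat.cast_choose ℂ (by omega : k - 1 ≤ m - 1), show m - 1 - (k - 1) = m - k by omega,
    neg_pow (conj z₀)]
  have h1 : (k.factorial : ℂ) ≠ 0 := by exact_mod_cast k.factorial_ne_zero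
  have h2 : ((k - 1).factorial : ℂ) ≠ 0 := by exact_mod_cast (k - 1).factorial_ne_zero
  have h3 : ((m - k).factorial : ℂ) ≠ 0 := by exact_mod_cast (m - k).factorial_ne_zero
  field_simp

/-- Solving for `F - a` gives `(1 - |a|²) g / (1 + conj a g)`, a geometric series in `g`. The term
linear in `g` is separated; the higher powers are Bell polynomials. -/
theorem factorial_mul_coeff_eq_bellA {a : ℂ} {F g : ℂ⟦X⟧} (hg : X ∣ g)
    (h : (F - C a) * (1 + C (conj a) * g) = C ((1 - ‖a‖ ^ 2 : ℝ) : ℂ) * g) {m : ℕ} (hm : 1 ≤ m) :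
    (m.factorial : ℂ) * coeff m F = ((1 - ‖a‖ ^ 2 : ℝ) : ℂ) *
      ((m.factorial : ℂ) * coeff m g + ∑ k ∈ Finset.Icc 2 m, (k.factorial : ℂ) *
        (-conj a) ^ (k - 1) * bellA m k (fun i => (i.factorial : ℂ) * coeff i g)) := by
  set q : ℂ⟦X⟧ := C (-conj a) * g with hq
  have hF : X ∣ F - C a := by
    have hu : IsUnit (1 + C (conj a) * g) := by
      rw [isUnit_iff_constantCoeff]
      simp [X_dvd_iff.1 hg]
    rw [← hu.dvd_mul_right, h]
    exact hg.mul_left _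
  have h1 : 1 + C (conj a) * g = 1 - q := by rw [hq, map_neg]; ring
  rw [h1] at h
  have h2 : F = C a + ∑ k ∈ Finset.range m, C (((1 - ‖a‖ ^ 2 : ℝ) : ℂ) * (-conj a) ^ k) * g ^ (k + 1) +
      (F - C a) * q ^ m := by
    have := mul_neg_geom_sum q m
    have h3 : (F - C a) * (1 - q ^ m) = C ((1 - ‖a‖ ^ 2 : ℝ) : ℂ) * g * ∑ i ∈ Finset.range m, q ^ i := by
      rw [← this, ← mul_assoc, h]
    have h4 : C ((1 - ‖a‖ ^ 2 : ℝ) : ℂ) * g * ∑ i ∈ Finset.range m, q ^ i =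
        ∑ k ∈ Finset.range m, C (((1 - ‖a‖ ^ 2 : ℝ) : ℂ) * (-conj a) ^ k) * g ^ (k + 1) := by
      rw [Finset.mul_sum]
      refine Finset.sum_congr rfl fun k _ => ?_
      rw [hq, map_mul, map_pow]
      ring
    rw [← h4, ← h3]
    ring
  -- The tail of the geometric sum has order at least `m + 1`: one from `F - a`, and `m` from `q^m`.
  have h5 : coeff m ((F - C a) * q ^ m) = 0 := by
    refine X_pow_dvd_iff.1 ?_ m (Nat.lt_succ_self m)
    rw [pow_succ']
    exact mul_dvd_mul hF (pow_dvd_pow_of_dvd (hg.mul_left _) m)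
  rw [h2, map_add, h5, add_zero, map_add, coeff_C, if_neg (by omega), zero_add, map_sum]
  obtain ⟨m, rfl⟩ := Nat.exists_eq_add_of_le' hm
  have h6 : Finset.Icc 2 (m + 1) = Finset.Ico (0 + 2) (m + 2) := by ext; simp; omega
  rw [Finset.sum_range_succ', h6, ← Finset.sum_Ico_add', ← Finset.range_eq_Ico, mul_add, mul_add,
    add_comm, Finset.mul_sum, Finset.mul_sum]
  congr 1
  · rw [coeff_C_mul]
    simp
    ring
  · refine Finset.sum_congr rfl fun k hk => ?_
    have hk' := Finset.mem_range.1 hk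
    rw [coeff_C_mul, mul_left_comm, coeff_pow_eq_bellA (by omega) (by omega) hg]
    simp only [show k + 2 - 1 = k + 1 from rfl]
    ring

end SchwarzPick
end

/-! ### Blaschke products under Möbius maps -/

noncomputable section
namespace SchwarzPick
open Polynomial

/-- The reciprocal identity `z ^ #s * conj (p(1 / conj z)) = p*(z)` for `p = ∏ (X - a)`. -/
theorem pow_mul_conj_prod_sub (s : Multiset ℂ) {z : ℂ} (hz : z ≠ 0) :
    z ^ Multiset.card s * conj ((s.map fun a => (conj z)⁻¹ - a).prod) =
      (s.map fun a => 1 - conj a * z).prod := by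
  induction s using Multiset.induction_on with
  | empty => simp
  | cons a s ih =>
    simp only [Multiset.card_cons, Multiset.map_cons, Multiset.prod_cons, map_mul, ← ih, map_sub,
      map_inv₀, Complex.conj_conj]
    have h : z * (z⁻¹ - conj a) = 1 - conj a * z := by
      rw [mul_sub, mul_inv_cancel₀ hz, mul_comm]
    rw [← h]
    ring

theorem norm_prod_one_sub_le (s : Multiset ℂ) (hs : ∀ a ∈ s, ‖a‖ < 1) {z : ℂ} (hz : 1 ≤ ‖z‖) :
    ‖(s.map fun a => 1 - conj a * z).prod‖ ≤ ‖(s.map fun a => z - a).prod‖ := by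
  induction s using Multiset.induction_on with
  | empty => simp
  | cons a s ih =>
    simp only [Multiset.map_cons, Multiset.prod_cons, norm_mul]
    refine mul_le_mul ?_ (ih fun b hb => hs b (Multiset.mem_cons_of_mem hb)) (norm_nonneg _)
      (norm_nonneg _)
    have h := normSq_sub_normSq_mobius (-a) z
    rw [map_neg, neg_mul, ← sub_eq_add_neg, ← sub_eq_add_neg, norm_neg] at h
    refine le_of_sq_le_sq ?_ (norm_nonneg _)
    nlinarith [one_sub_norm_sq_pos (hs a (Multiset.mem_cons_self a s)), one_le_pow₀ hz (n := 2),
      mul_nonneg (one_sub_norm_sq_pos (hs a (Multiset.mem_cons_self a s))).le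
      (sub_nonneg.2 (one_le_pow₀ hz (n := 2)))]

/-- The left side is the numerator of `T_a(u P / Q)`. Its degree does not drop because the leading
coefficient of `a Q` is smaller than `|u| = 1`. A zero with `|z| ≥ 1` would force `|P| = |a| |Q| <
|P|`, since `|Q| ≤ |P|` and `P ≠ 0` there. -/
theorem exists_prod_add_mul_prod_eq (s : Multiset ℂ) (hs : ∀ a ∈ s, ‖a‖ < 1) {u a : ℂ}
    (hu : ‖u‖ = 1) (ha : ‖a‖ < 1) :
    ∃ (c : ℂ) (t : Multiset ℂ), c ≠ 0 ∧ Multiset.card t = Multiset.card s ∧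
      (∀ b ∈ t, ‖b‖ < 1) ∧
      ∀ z, u * (s.map fun b => z - b).prod + a * (s.map fun b => 1 - conj b * z).prod =
        c * (t.map fun b => z - b).prod := by
  set p : ℂ[X] := (s.map fun b => X - C b).prod
  set q : ℂ[X] := (s.map fun b => 1 - C (conj b) * X).prod
  set r : ℂ[X] := C u * p + C a * q with hr
  have hp : ∀ z, p.eval z = (s.map fun b => z - b).prod := fun z => by
    simp [p, eval_multiset_prod, Multiset.map_map]
  have hq : ∀ z, q.eval z = (s.map fun b => 1 - conj b * z).prod := fun z => by
    simp [q, eval_multiset_prod, Multiset.map_map]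
  have hpdeg : p.natDegree = Multiset.card s := natDegree_multiset_prod_X_sub_C_eq_card s
  have hpmon : p.Monic := monic_multiset_prod_of_monic _ _ fun b _ => monic_X_sub_C b
  have hqdeg : q.natDegree ≤ Multiset.card s := by
    refine (natDegree_multiset_prod_le _).trans ?_
    rw [Multiset.map_map]
    refine (Multiset.sum_le_card_nsmul _ 1 ?_).trans (by simp)
    intro x hx
    obtain ⟨b, -, rfl⟩ := Multiset.mem_map.1 hx
    simp only [Function.comp]
    compute_degree
  have hqlead : ‖q.coeff (Multiset.card s)‖ ≤ 1 := by
    have h1 := coeff_multiset_prod_of_natDegree_le (s.map fun b => 1 - C (conj b) * X) 1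
      fun x hx => by
        obtain ⟨b, -, rfl⟩ := Multiset.mem_map.1 hx
        compute_degree
    rw [Multiset.card_map, mul_one, Multiset.map_map] at h1
    rw [h1]
    clear * - hs
    induction s using Multiset.induction_on with
    | empty => simp
    | cons b s ih =>
      rw [Multiset.map_cons, Multiset.prod_cons, norm_mul]
      refine mul_le_one₀ ?_ (norm_nonneg _) (ih fun c hc => hs c (Multiset.mem_cons_of_mem hc))
      simpa [coeff_one] using (hs b (Multiset.mem_cons_self b s)).le
  have hrcoeff : r.coeff (Multiset.card s) ≠ 0 := by
    have h1 : r.coeff (Multiset.card s) = u + a * q.coeff (Multiset.card s) := by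
      rw [hr, coeff_add, coeff_C_mul, coeff_C_mul, ← hpdeg, hpmon.coeff_natDegree, mul_one]
    intro h
    have h2 : ‖u‖ = ‖a * q.coeff (Multiset.card s)‖ := by
      rw [← norm_neg (a * _)]
      congr 1
      linear_combination h1.symm.trans h
    rw [hu, norm_mul] at h2
    nlinarith [norm_nonneg a, norm_nonneg (q.coeff (Multiset.card s))]
  have hrdeg : r.natDegree = Multiset.card s := by
    refine le_antisymm ?_ (le_natDegree_of_ne_zero hrcoeff)
    exact natDegree_add_le_of_degree_le ((natDegree_C_mul_le _ _).trans hpdeg.le)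
      ((natDegree_C_mul_le _ _).trans hqdeg)
  have hr0 : r ≠ 0 := fun h => hrcoeff (by rw [h, coeff_zero])
  have hsplit := IsAlgClosed.splits r
  refine ⟨r.leadingCoeff, r.roots, leadingCoeff_ne_zero.2 hr0, ?_, fun b hb => ?_, fun z => ?_⟩
  · rw [← hrdeg, hsplit.natDegree_eq_card_roots]
  · by_contra! hb1
    have h1 : r.eval b = 0 := (mem_roots hr0).1 hb
    rw [hr, eval_add, eval_mul, eval_mul, eval_C, eval_C, hp, hq] at h1
    have h2 : ‖(s.map fun c => b - c).prod‖ = ‖a‖ * ‖(s.map fun c => 1 - conj c * b).prod‖ := by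
      have : u * (s.map fun c => b - c).prod = -(a * (s.map fun c => 1 - conj c * b).prod) := by
        linear_combination h1
      have := congrArg norm this
      rwa [norm_mul, hu, one_mul, norm_neg, norm_mul] at this
    have h3 := norm_prod_one_sub_le s hs hb1
    have h4 : 0 < ‖(s.map fun c => b - c).prod‖ := by
      rw [norm_pos_iff]
      refine Multiset.prod_ne_zero fun h => ?_
      obtain ⟨c, hc, hbc⟩ := Multiset.mem_map.1 h
      have := hs c hc
      rw [← sub_eq_zero.1 hbc] at this
      linarith
    nlinarith [norm_nonneg a, norm_nonneg (s.map fun c => 1 - conj c * b).prod]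
  · have := congrArg (eval z) hsplit.eq_prod_roots
    rw [eval_mul, eval_C, eval_multiset_prod, Multiset.map_map, hr, eval_add, eval_mul, eval_mul,
      eval_C, eval_C, hp, hq] at this
    simpa using this

/-- Reflecting the numerator identity at the unit circle yields the denominator. The reflection
excludes `z = 0`, which is recovered by continuity. -/
theorem conj_prod_add_mul_prod_eq (s t : Multiset ℂ) (hst : Multiset.card t = Multiset.card s)
    {u a c : ℂ}
    (h : ∀ z, u * (s.map fun b => z - b).prod + a * (s.map fun b => 1 - conj b * z).prod =
        c * (t.map fun b => z - b).prod) (z : ℂ) :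
    conj u * (s.map fun b => 1 - conj b * z).prod + conj a * (s.map fun b => z - b).prod =
      conj c * (t.map fun b => 1 - conj b * z).prod := by
  have hcont : ∀ v : Multiset ℂ, Continuous fun z => (v.map fun b => 1 - conj b * z).prod := fun v =>
    continuous_multiset_prod (f := fun b z => 1 - conj b * z) v fun b _ => by fun_prop
  have hcont' : ∀ v : Multiset ℂ, Continuous fun z => (v.map fun b => z - b).prod := fun v =>
    continuous_multiset_prod (f := fun b z => z - b) v fun b _ => by fun_prop
  have key := Continuous.ext_on (dense_compl_singleton (0 : ℂ))
    (((hcont s).const_mul (conj u)).add ((hcont' s).const_mul (conj a)))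
    ((hcont t).const_mul (conj c)) (fun z hz => ?_)
  · exact congrFun key z
  · have hz : z ≠ 0 := hz
    have h1 := congrArg conj (h (conj z)⁻¹)
    simp only [map_add, map_mul] at h1
    have h3 := pow_mul_conj_prod_sub s hz
    have h4 := pow_mul_conj_prod_sub t hz
    have h5 : z ^ Multiset.card s * conj ((s.map fun b => 1 - conj b * (conj z)⁻¹).prod) =
        (s.map fun b => z - b).prod := by
      have := pow_mul_conj_prod_sub s (z := (conj z)⁻¹) (by simpa using hz)
      rw [map_inv₀, inv_inv, Complex.conj_conj] at this
      rw [← this, map_mul, Complex.conj_conj, map_pow, map_inv₀, Complex.conj_conj, ← mul_assoc,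
        ← mul_pow, mul_inv_cancel₀ hz, one_pow, one_mul]
    rw [Pi.add_apply, ← h3, ← h4, ← h5, hst]
    linear_combination z ^ Multiset.card s * h1

theorem isBlaschke_iff_multiset {n : ℕ} {f : ℂ → ℂ} : IsBlaschke n f ↔
    ∃ (u : ℂ) (s : Multiset ℂ), ‖u‖ = 1 ∧ Multiset.card s = n ∧ (∀ a ∈ s, ‖a‖ < 1) ∧
      ∀ z ∈ unitDisk, f z =
        u * ((s.map fun a => z - a).prod / (s.map fun a => 1 - conj a * z).prod) := by
  constructor
  · rintro ⟨θ, a, ha, h⟩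
    refine ⟨Complex.exp (θ * Complex.I), Finset.univ.val.map a, Complex.norm_exp_ofReal_mul_I θ,
      by simp, fun b hb => ?_, fun z hz => ?_⟩
    · obtain ⟨i, -, rfl⟩ := Multiset.mem_map.1 hb
      exact mem_unitDisk.1 (ha i)
    · rw [h z hz, Multiset.map_map, Multiset.map_map]
      simp only [pdist, Finset.prod_div_distrib]
      rfl
  · rintro ⟨u, s, hu, rfl, hs, h⟩
    refine ⟨u.arg, fun i => s.toList.get (i.cast (by simp)), fun i => ?_, fun z hz => ?_⟩
    · exact mem_unitDisk.2 (hs _ (Multiset.mem_toList.1 (List.get_mem _ _)))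
    · have hue : Complex.exp (u.arg * Complex.I) = u := by
        have := Complex.norm_mul_exp_arg_mul_I u
        rwa [hu, Complex.ofReal_one, one_mul] at this
      rw [h z hz, hue, ← Multiset.prod_map_div]
      congr 1
      conv_lhs => rw [← Multiset.coe_toList s]
      rw [Multiset.map_coe, Multiset.prod_coe, ← List.prod_ofFn]
      congr 1
      refine List.ext_getElem (by simp) fun i _ _ => by simp [pdist]

theorem IsBlaschke.congr {n : ℕ} {f g : ℂ → ℂ} (hf : IsBlaschke n f) (h : Set.EqOn g f unitDisk) :
    IsBlaschke n g := by
  obtain ⟨θ, a, ha, hf⟩ := hf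
  exact ⟨θ, a, ha, fun z hz => (h hz).trans (hf z hz)⟩

theorem isBlaschke_zero_const {u : ℂ} (hu : ‖u‖ = 1) : IsBlaschke 0 fun _ => u :=
  isBlaschke_iff_multiset.2 ⟨u, 0, hu, rfl, by simp, by simp⟩

theorem IsBlaschke.mobius_neg_mul {n : ℕ} {f : ℂ → ℂ} (hf : IsBlaschke n f) {z₀ : ℂ}
    (hz₀ : z₀ ∈ unitDisk) : IsBlaschke (n + 1) fun z => mobius (-z₀) z * f z := by
  obtain ⟨θ, a, ha, hf⟩ := hf
  refine ⟨θ, Fin.cons z₀ a, Fin.cases hz₀ ha, fun z hz => ?_⟩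
  simp only [Fin.prod_univ_succ, hf z hz, ← pdist_eq_mobius, Fin.cons_zero, Fin.cons_succ]
  ring

theorem IsBlaschke.mobius {n : ℕ} {f : ℂ → ℂ} (hf : IsBlaschke n f) {a : ℂ} (ha : ‖a‖ < 1) :
    IsBlaschke n fun z => mobius a (f z) := by
  obtain ⟨u, s, hu, hcard, hs, h⟩ := isBlaschke_iff_multiset.1 hf
  obtain ⟨c, t, hc, htcard, ht, hct⟩ := exists_prod_add_mul_prod_eq s hs hu ha
  have hu0 : u ≠ 0 := norm_ne_zero_iff.1 (by rw [hu]; exact one_ne_zero)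
  have hcc : conj c ≠ 0 := by simpa using hc
  -- Numerator `c P'` over denominator `1 + conj a u P / Q = u conj c Q' / Q`, using `u conj u = 1`,
  -- leaves this unimodular constant.
  refine isBlaschke_iff_multiset.2 ⟨u⁻¹ * (c / conj c), t, ?_, htcard.trans hcard, ht,
    fun z hz => ?_⟩
  · rw [norm_mul, norm_inv, norm_div, Complex.norm_conj, hu, inv_one, one_mul, div_self (norm_ne_zero_iff.2 hc)]
  · have hne : ∀ v : Multiset ℂ, (∀ b ∈ v, ‖b‖ < 1) → (v.map fun b => 1 - conj b * z).prod ≠ 0 := by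
      intro v hv
      refine Multiset.prod_ne_zero fun h0 => ?_
      obtain ⟨b, hb, hb0⟩ := Multiset.mem_map.1 h0
      refine one_add_conj_mul_ne_zero (a := -b) (by simpa using hv b hb) (mem_unitDisk.1 hz).le ?_
      rw [← hb0, map_neg]; ring
    have h1 := hct z
    have h2 := conj_prod_add_mul_prod_eq s t htcard hct z
    have hs' := hne s hs
    have ht' := hne t ht
    have huu : u * conj u = 1 := by rw [Complex.mul_conj', hu]; simp
    rw [h z hz]
    set P := (s.map fun b => z - b).prod
    set Q := (s.map fun b => 1 - conj b * z).prod
    set P' := (t.map fun b => z - b).prod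
    set Q' := (t.map fun b => 1 - conj b * z).prod
    have hden : 1 + conj a * (u * (P / Q)) = u * (conj c * Q') / Q := by
      rw [← h2]
      field_simp
      linear_combination (-Q) * huu
    have hnum : u * (P / Q) + a = c * P' / Q := by
      rw [← h1]
      field_simp
    rw [SchwarzPick.mobius, hden, hnum]
    field_simp

theorem IsBlaschke.nested {n : ℕ} {h : ℂ → ℂ} (hh : IsBlaschke n h) {z₀ : ℂ} (hz₀ : z₀ ∈ unitDisk)
    {γ : ℕ → ℂ} {m : ℕ} (hγ : ∀ k < m, ‖γ k‖ < 1) : IsBlaschke (m + n) (nested z₀ γ m h) := by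
  induction m generalizing n h with
  | zero => rwa [zero_add]
  | succ m ih =>
    have := ih ((hh.mobius_neg_mul hz₀).mobius (hγ m (by omega))) fun k hk => hγ k (by omega)
    rwa [← add_assoc, add_right_comm] at this

end SchwarzPick
end

/-! ### The affine formula for the derivative of order `n` -/

noncomputable section
namespace SchwarzPick

section PeschlDerivatives
open PowerSeries

theorem diskCenter_congr {z₀ : ℂ} {γ δ : ℕ → ℂ} {n : ℕ} (hn : 1 ≤ n) (h : ∀ k < n, γ k = δ k) :
    diskCenter z₀ γ n = diskCenter z₀ δ n := by
  induction n using Nat.strong_induction_on with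
  | _ n ih =>
    have hG : schurG n γ = schurG n δ := schurF_congr fun i _ hi => by
      rcases hi.eq_or_lt with rfl | hi
      · simp
      · rw [Function.update_of_ne hi.ne, Function.update_of_ne hi.ne, h i hi]
    have hS : ∀ i : Fin (n - 1), diskCenter z₀ γ (i.1 + 1) +
        (diskRadius z₀ γ (i.1 + 1) : ℂ) * γ (i.1 + 1) = diskCenter z₀ δ (i.1 + 1) +
        (diskRadius z₀ δ (i.1 + 1) : ℂ) * δ (i.1 + 1) := fun i => by
      have := i.2
      have hR : diskRadius z₀ γ (i.1 + 1) = diskRadius z₀ δ (i.1 + 1) := by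
        rw [diskRadius, diskRadius, Finset.prod_congr rfl fun k hk => by
          rw [h k (by have := Finset.mem_range.1 hk; omega)]]
      rw [ih (i.1 + 1) (by omega) (by omega) fun k hk => h k (by omega), hR, h (i.1 + 1) (by omega)]
    -- Since `k ≥ 2`, the arguments of the Bell polynomial have index at most `n - 1`.
    have hB : ∀ k ∈ Finset.Icc 2 n, bellA n k (fun m => (m.factorial : ℂ) * schurF m γ) =
        bellA n k (fun m => (m.factorial : ℂ) * schurF m δ) := fun k hk => by
      rw [Finset.mem_Icc] at hk
      rw [bellA, bellA]
      congr 1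
      refine Finset.sum_congr rfl fun j _ => Finset.prod_congr rfl fun i hi => ?_
      rw [Finset.mem_Icc] at hi
      rw [schurF_congr fun l _ hl => h l (by omega)]
    rw [diskCenter, diskCenter, hG, h 0 (by omega)]
    simp only [hS]
    congr 3
    exact Finset.sum_congr rfl fun k hk => by rw [hB k hk]

/-- One step of Schur's algorithm, cleared of denominators. In this form it survives termination:
for a unimodular constant the next quotient is zero and both sides equal that constant. -/
theorem taylorPS_iterate_hypDiff {f : ℂ → ℂ} (hf : IsSchur f) {z₀ : ℂ} (hz₀ : z₀ ∈ unitDisk)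
    (k : ℕ) :
    taylorPS (fun w => (hypDiff z₀)^[k] f (mobius z₀ w)) 0 *
      (1 + C (conj ((hypDiff z₀)^[k] f z₀)) *
        (X * taylorPS (fun w => (hypDiff z₀)^[k + 1] f (mobius z₀ w)) 0)) =
      X * taylorPS (fun w => (hypDiff z₀)^[k + 1] f (mobius z₀ w)) 0 +
        C ((hypDiff z₀)^[k] f z₀) := by
  have h0 := mem_unitDisk.1 hz₀
  have hg := hf.iterate_hypDiff hz₀ k
  have hT := isSelfMap_mobius h0
  have hgT := (hg.comp hT).analyticAt zero_mem_unitDisk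
  have hgT' := ((hf.iterate_hypDiff hz₀ (k + 1)).comp hT).analyticAt zero_mem_unitDisk
  rw [Function.iterate_succ_apply'] at hgT' ⊢
  generalize (hypDiff z₀)^[k] f = g at hg hgT hgT' ⊢
  generalize hG : (fun w => g (mobius z₀ w)) = G at hgT ⊢
  rw [← taylorPS_sub_const 0, ← taylorPS_const _ 0, ← taylorPS_const _ 0, ← map_one (C (R := ℂ)),
    ← taylorPS_const _ 0, ← taylorPS_mul (by fun_prop) (by fun_prop),
    ← taylorPS_mul (by fun_prop) (by fun_prop), ← taylorPS_add (by fun_prop) (by fun_prop),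
    ← taylorPS_mul (by fun_prop) (by fun_prop), ← taylorPS_add (by fun_prop) (by fun_prop)]
  subst hG
  refine taylorPS_congr ?_
  filter_upwards [unitDisk_mem_nhds zero_mem_unitDisk] with w hw
  have hTw := hT.2 hw
  rw [sub_zero]
  rcases (hg.norm_le hz₀).eq_or_lt with h | h
  · rw [hypDiff_eqOn_zero hg hz₀ h hTw, hg.eqOn_const hz₀ h hTw]
    ring
  · have e := mobius_neg_mul_hypDiff g hz₀ hTw
    have hne := one_add_conj_mul_ne_zero (a := -g z₀) (by simpa) (hg.norm_le hTw)
    rw [mobius_neg_mobius h0 (mem_unitDisk.1 hw).le] at e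
    have e' := (eq_div_iff hne).1 e
    rw [map_neg] at e'
    linear_combination -e'

/-- Two evaluations of the `m`-th coefficient of `f ∘ T_{z₀}` are equated. Lower derivatives are
known by induction, and the top one has coefficient `α_{m,m} = 1` up to the power of `1 - |z₀|²`. -/
theorem iteratedDeriv_eq_diskCenter_add_aux {f : ℂ → ℂ} (hf : IsSchur f) {z₀ : ℂ}
    (hz₀ : z₀ ∈ unitDisk) (h0 : ‖f z₀‖ < 1) {m : ℕ} (hm : 1 ≤ m) :
    iteratedDeriv m f z₀ = diskCenter z₀ (fun k => (hypDiff z₀)^[k] f z₀) m +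
      diskRadius z₀ (fun k => (hypDiff z₀)^[k] f z₀) m * (hypDiff z₀)^[m] f z₀ := by
  set δ : ℕ → ℂ := fun k => (hypDiff z₀)^[k] f z₀
  set φ : ℕ → ℂ⟦X⟧ := fun k => taylorPS (fun w => (hypDiff z₀)^[k] f (mobius z₀ w)) 0
  have hφ : ∀ k, φ k * (1 + C (conj (δ k)) * (X * φ (k + 1))) = X * φ (k + 1) + C (δ k) :=
    taylorPS_iterate_hypDiff hf hz₀
  have hz1 := mem_unitDisk.1 hz₀
  have hF : (φ 0 - C (δ 0)) * (1 + C (conj (δ 0)) * (X * φ 1)) =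
      C ((1 - ‖δ 0‖ ^ 2 : ℝ) : ℂ) * (X * φ 1) := by
    rw [ofReal_one_sub_norm_sq, map_sub, map_one, map_mul]
    linear_combination hφ 0
  have hcoeff : ∀ i, coeff i (X * φ 1) = schurF i δ := fun i => coeff_X_mul_eq_schurF hφ i 0
  induction m using Nat.strong_induction_on with
  | _ m ih =>
    have e1 := factorial_mul_coeff_eq_bellA (dvd_mul_right X (φ 1)) hF hm
    have e2 := factorial_mul_coeff_taylorPS_comp_mobius hz1 (hf.analyticAt hz₀) hm
    have e3 : φ 0 = taylorPS (fun w => f (mobius z₀ w)) 0 := rfl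
    rw [← e3, e1] at e2
    simp only [hcoeff] at e2
    obtain ⟨p, rfl⟩ := Nat.exists_eq_add_of_le' hm
    have hα : alphaCoeff (p + 1) (p + 1) = 1 := by
      have h1 : ((p + 1).factorial : ℂ) ≠ 0 := by exact_mod_cast (p + 1).factorial_ne_zero
      have h2 : (p.factorial : ℂ) ≠ 0 := by exact_mod_cast p.factorial_ne_zero
      simp [alphaCoeff, h1, h2]
    have hA : ((1 - ‖z₀‖ ^ 2 : ℝ) : ℂ) ≠ 0 := by exact_mod_cast (one_sub_norm_sq_pos hz1).ne'
    have hB : ((1 - ‖δ 0‖ ^ 2 : ℝ) : ℂ) ≠ 0 := by exact_mod_cast (one_sub_norm_sq_pos h0).ne'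
    rw [Finset.sum_Icc_succ_top (by omega : 1 ≤ p + 1), hα, Nat.sub_self, pow_zero, one_mul, one_mul,
      schurF_eq_schurG_add hm] at e2
    have hS : ∑ k ∈ Finset.Icc 1 p, alphaCoeff (p + 1) k * conj z₀ ^ (p + 1 - k) *
          ((1 - ‖z₀‖ ^ 2 : ℝ) : ℂ) ^ k * iteratedDeriv k f z₀ =
        ((1 - ‖δ 0‖ ^ 2 : ℝ) : ℂ) * ∑ i : Fin (p + 1 - 1),
          alphaCoeff (p + 1) (i.1 + 1) * conj z₀ ^ (p + 1 - (i.1 + 1)) *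
            ((1 - ‖z₀‖ ^ 2 : ℝ) : ℂ) ^ (i.1 + 1) *
            (diskCenter z₀ δ (i.1 + 1) + (diskRadius z₀ δ (i.1 + 1) : ℂ) * δ (i.1 + 1)) /
              ((1 - ‖δ 0‖ ^ 2 : ℝ) : ℂ) := by
      have hI : Finset.Icc 1 p = Finset.Ico (0 + 1) (p + 1) := by ext; simp
      rw [hI, ← Finset.sum_Ico_add', ← Finset.range_eq_Ico, Finset.mul_sum, Finset.sum_range]
      refine Finset.sum_congr rfl fun i _ => ?_
      have := i.2
      rw [ih (i.1 + 1) (by omega) (by omega), mul_div_cancel₀ _ hB]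
    rw [hS] at e2
    have hR : (diskRadius z₀ δ (p + 1) : ℂ) = ((p + 1).factorial : ℂ) *
        (((1 - ‖δ 0‖ ^ 2 : ℝ) : ℂ) * ∏ k ∈ Finset.Ico 1 (p + 1), ((1 - ‖δ k‖ ^ 2 : ℝ) : ℂ)) /
          ((1 - ‖z₀‖ ^ 2 : ℝ) : ℂ) ^ (p + 1) := by
      rw [diskRadius, Finset.range_eq_Ico, Finset.prod_eq_prod_Ico_succ_bot (by omega)]
      push_cast
      rfl
    rw [diskCenter, hR]
    refine mul_left_cancel₀ (pow_ne_zero (p + 1) hA) ?_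
    generalize (∑ i : Fin (p + 1 - 1), _ : ℂ) = S at e2 ⊢
    generalize (∑ k ∈ Finset.Icc 2 (p + 1), _ : ℂ) = B at e2 ⊢
    field_simp
    linear_combination -e2

/-- The derivative of order `n` is an affine function of the hyperbolic derivative of order `n`,
given those of lower order. -/
theorem iteratedDeriv_eq_diskCenter_add {f : ℂ → ℂ} (hf : IsSchur f) {z₀ : ℂ}
    (hz₀ : z₀ ∈ unitDisk) {n : ℕ} (hn : 1 ≤ n) {γ : ℕ → ℂ} (h0 : ‖γ 0‖ < 1)
    (hγ : ∀ k < n, (hypDiff z₀)^[k] f z₀ = γ k) :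
    iteratedDeriv n f z₀ = diskCenter z₀ γ n + diskRadius z₀ γ n * (hypDiff z₀)^[n] f z₀ := by
  have hR : diskRadius z₀ γ n = diskRadius z₀ (fun k => (hypDiff z₀)^[k] f z₀) n := by
    rw [diskRadius, diskRadius, Finset.prod_congr rfl fun k hk => by
      rw [← hγ k (Finset.mem_range.1 hk)]]
  rw [hR, diskCenter_congr hn fun k hk => (hγ k hk).symm]
  exact iteratedDeriv_eq_diskCenter_add_aux hf hz₀ (by rw [← hγ 0 hn] at h0; exact h0) hn

end PeschlDerivatives

theorem diskRadius_pos {z₀ : ℂ} (hz₀ : z₀ ∈ unitDisk) {γ : ℕ → ℂ} {n : ℕ}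
    (hγ : ∀ k < n, ‖γ k‖ < 1) : 0 < diskRadius z₀ γ n :=
  div_pos (mul_pos (by exact_mod_cast n.factorial_pos)
    (Finset.prod_pos fun k hk => one_sub_norm_sq_pos (hγ k (Finset.mem_range.1 hk))))
    (pow_pos (one_sub_norm_sq_pos (mem_unitDisk.1 hz₀)) n)

theorem mem_interpClass_iff {n : ℕ} (hn : 1 ≤ n) {z₀ : ℂ} {γ : ℕ → ℂ} {f : ℂ → ℂ} :
    f ∈ interpClass n z₀ γ ↔ IsSelfMap f ∧ ∀ k < n, (hypDiff z₀)^[k] f z₀ = γ k := by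
  refine and_congr_right fun _ => ⟨fun h k hk => ?_, fun h => ⟨h 0 hn, fun k _ hk => h k hk⟩⟩
  rcases Nat.eq_zero_or_pos k with rfl | hk0
  · exact h.1
  · exact h.2 k hk0 hk

theorem extremal_mem_interpClass {n : ℕ} (hn : 1 ≤ n) {z₀ : ℂ} (hz₀ : z₀ ∈ unitDisk) {γ : ℕ → ℂ}
    (hγ : ∀ k < n, ‖γ k‖ < 1) {ε : ℂ} (hε : ‖ε‖ ≤ 1) :
    extremal n z₀ γ ε ∈ interpClass n z₀ γ := by
  refine (mem_interpClass_iff hn).2 ⟨?_, fun k hk =>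
    iterate_hypDiff_nested_apply (isSchur_const hε) hz₀ hγ hk⟩
  -- A unimodular constant `ε` is not itself a map into the open disk, but the innermost Möbius step
  -- makes it one; this needs `n ≥ 1`.
  obtain ⟨m, rfl⟩ := Nat.exists_eq_add_of_le' hn
  exact ((isSchur_const hε).isSelfMap_step (hγ m (by omega)) hz₀).nested hz₀
    fun k hk => hγ k (by omega)

theorem iteratedDeriv_extremal {n : ℕ} (hn : 1 ≤ n) {z₀ : ℂ} (hz₀ : z₀ ∈ unitDisk) {γ : ℕ → ℂ}
    (hγ : ∀ k < n, ‖γ k‖ < 1) {ε : ℂ} (hε : ‖ε‖ ≤ 1) :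
    iteratedDeriv n (extremal n z₀ γ ε) z₀ = diskCenter z₀ γ n + diskRadius z₀ γ n * ε := by
  obtain ⟨hs, hk⟩ := (mem_interpClass_iff hn).1 (extremal_mem_interpClass hn hz₀ hγ hε)
  rw [iteratedDeriv_eq_diskCenter_add hs.isSchur hz₀ hn (hγ 0 hn) hk]
  congr 2
  exact iterate_hypDiff_nested (isSchur_const hε) hz₀ hγ hz₀

theorem norm_ofReal_mul_of_pos {r : ℝ} (hr : 0 < r) (w : ℂ) : ‖(r : ℂ) * w‖ = r * ‖w‖ := by
  rw [norm_mul, Complex.norm_of_nonneg hr.le]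

theorem setOf_iteratedDeriv_extremal {n : ℕ} (hn : 1 ≤ n) {z₀ : ℂ} (hz₀ : z₀ ∈ unitDisk)
    {γ : ℕ → ℂ} (hγ : ∀ k < n, ‖γ k‖ < 1) :
    {w | ∃ ε : ℂ, ‖ε‖ ≤ 1 ∧ iteratedDeriv n (extremal n z₀ γ ε) z₀ = w} =
      Metric.closedBall (diskCenter z₀ γ n) (diskRadius z₀ γ n) := by
  have hρ := diskRadius_pos hz₀ hγ
  ext w
  rw [Set.mem_ofPred_eq, mem_closedBall_iff_norm]
  constructor
  · rintro ⟨ε, hε, rfl⟩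
    rw [iteratedDeriv_extremal hn hz₀ hγ hε, add_sub_cancel_left, norm_ofReal_mul_of_pos hρ]
    exact mul_le_of_le_one_right hρ.le hε
  · intro hw
    have hε : ‖(w - diskCenter z₀ γ n) / (diskRadius z₀ γ n : ℂ)‖ ≤ 1 := by
      rwa [norm_div, Complex.norm_of_nonneg hρ.le, div_le_one hρ]
    refine ⟨_, hε, ?_⟩
    rw [iteratedDeriv_extremal hn hz₀ hγ hε, mul_div_cancel₀ _ (by exact_mod_cast hρ.ne')]
    ring

theorem diskRadius_eq_zero {z₀ : ℂ} {γ : ℕ → ℂ} {n j : ℕ} (hj : j < n) (h : ‖γ j‖ = 1) :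
    diskRadius z₀ γ n = 0 := by
  rw [diskRadius, Finset.prod_eq_zero (Finset.mem_range.2 hj) (by rw [h]; norm_num), mul_zero,
    zero_div]

end SchwarzPick
end

/-! ### The theorem -/

theorem mainTheorem2 (n : ℕ) (hn : 1 ≤ n) (z₀ : ℂ) (hz₀ : z₀ ∈ SchwarzPick.unitDisk)
    (γ : ℕ → ℂ) (hγ : ∀ k < n, ‖γ k‖ ≤ 1) :
    (∀ f ∈ SchwarzPick.interpClass n z₀ γ, ∀ j, 1 ≤ j → j < n →
        (∀ k, 1 ≤ k → k < j → ‖γ k‖ < 1) → ‖γ j‖ = 1 → (∀ k, j < k → k < n → γ k = 0) →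
        iteratedDeriv n f z₀ = SchwarzPick.diskCenter z₀ γ n ∧
        (∀ z ∈ SchwarzPick.unitDisk, f z = SchwarzPick.nested z₀ γ j (fun _ => γ j) z) ∧
        SchwarzPick.IsBlaschke j f) ∧
    ((∀ k < n, ‖γ k‖ < 1) →
        {w | ∃ f ∈ SchwarzPick.interpClass n z₀ γ, iteratedDeriv n f z₀ = w} =
          Metric.closedBall (SchwarzPick.diskCenter z₀ γ n) (SchwarzPick.diskRadius z₀ γ n) ∧
        {w | ∃ ε : ℂ, ‖ε‖ ≤ 1 ∧ iteratedDeriv n (SchwarzPick.extremal n z₀ γ ε) z₀ = w} =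
          Metric.closedBall (SchwarzPick.diskCenter z₀ γ n) (SchwarzPick.diskRadius z₀ γ n) ∧
        (∀ ε : ℂ, ‖ε‖ = 1 → SchwarzPick.IsBlaschke n (SchwarzPick.extremal n z₀ γ ε)) ∧
        ∀ f ∈ SchwarzPick.interpClass n z₀ γ,
          (∃ fstar : ℂ → ℂ, SchwarzPick.IsSchur fstar ∧
            ∀ z ∈ SchwarzPick.unitDisk, f z = SchwarzPick.nested z₀ γ n fstar z) ∧
          (iteratedDeriv n f z₀ ∈
              Metric.sphere (SchwarzPick.diskCenter z₀ γ n) (SchwarzPick.diskRadius z₀ γ n) ↔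
            ∃ ε : ℂ, ‖ε‖ = 1 ∧
              ∀ z ∈ SchwarzPick.unitDisk, f z = SchwarzPick.extremal n z₀ γ ε z)) := by
  open SchwarzPick in
  refine ⟨fun f hf j hj hjn hγlt hγj _ => ?_, fun hγlt => ?_⟩
  · obtain ⟨hs, hk⟩ := (mem_interpClass_iff hn).1 hf
    -- This bound comes from `f` mapping into the open disk.
    have h0 : ‖γ 0‖ < 1 := by
      rw [← hk 0 hn]
      exact mem_unitDisk.1 (hs.2 hz₀)
    have hlt : ∀ k < j, ‖γ k‖ < 1 := fun k hkj => by
      rcases Nat.eq_zero_or_pos k with rfl | hk0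
      · exact h0
      · exact hγlt k hk0 hkj
    have hrep : Set.EqOn f (nested z₀ γ j fun _ => γ j) unitDisk := by
      refine (eqOn_nested_iterate_hypDiff hs.isSchur hz₀ hlt fun k hkj => hk k (hkj.trans hjn)).trans
        (nested_congr z₀ γ j ?_)
      -- The `j`-th quotient attains modulus one at an interior point, so the maximum principle
      -- makes it the constant `γ j`.
      have := (hs.isSchur.iterate_hypDiff hz₀ j).eqOn_const hz₀ (by rw [hk j hjn, hγj])
      rwa [hk j hjn] at this
    refine ⟨?_, hrep, ((isBlaschke_zero_const hγj).nested hz₀ hlt).congr hrep⟩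
    rw [iteratedDeriv_eq_diskCenter_add hs.isSchur hz₀ hn h0 hk, diskRadius_eq_zero hjn hγj,
      Complex.ofReal_zero, zero_mul, add_zero]
  · have hρ := diskRadius_pos hz₀ hγlt
    have hE := setOf_iteratedDeriv_extremal hn hz₀ hγlt
    refine ⟨Set.Subset.antisymm ?_ ?_, hE,
      fun ε hε => (isBlaschke_zero_const hε).nested hz₀ hγlt, fun f hf => ?_⟩
    · rintro w ⟨f, hf, rfl⟩
      obtain ⟨hs, hk⟩ := (mem_interpClass_iff hn).1 hf
      rw [iteratedDeriv_eq_diskCenter_add hs.isSchur hz₀ hn (hγlt 0 hn) hk, mem_closedBall_iff_norm,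
        add_sub_cancel_left, norm_ofReal_mul_of_pos hρ]
      exact mul_le_of_le_one_right hρ.le ((hs.isSchur.iterate_hypDiff hz₀ n).norm_le hz₀)
    · rw [← hE]
      rintro w ⟨ε, hε, rfl⟩
      exact ⟨_, extremal_mem_interpClass hn hz₀ hγlt hε, rfl⟩
    · obtain ⟨hs, hk⟩ := (mem_interpClass_iff hn).1 hf
      have hrep := eqOn_nested_iterate_hypDiff hs.isSchur hz₀ hγlt hk
      have hS := hs.isSchur.iterate_hypDiff hz₀ n
      refine ⟨⟨_, hS, hrep⟩, ?_⟩
      rw [mem_sphere_iff_norm, iteratedDeriv_eq_diskCenter_add hs.isSchur hz₀ hn (hγlt 0 hn) hk,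
        add_sub_cancel_left, norm_ofReal_mul_of_pos hρ, mul_eq_left₀ hρ.ne']
      constructor
      -- A boundary value means `|f*(z₀)| = 1`, hence `f*` is constant and `ε` is its value.
      · exact fun h => ⟨_, h, hrep.trans (nested_congr z₀ γ n (hS.eqOn_const hz₀ h))⟩
      · rintro ⟨ε, hε, h⟩
        rw [(iterate_hypDiff_congr hz₀ h n).trans
          (iterate_hypDiff_nested (isSchur_const hε.le) hz₀ hγlt) hz₀, hε]
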